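/- **Heavy-traffic optimality of power-of-two-choices routing.** *Model.* Let $M\ge 2$ identical servers work in discrete time; in each time slot each server can give one unit of service to each of at most $\mu\ge1$ different jobs. For each $\epsilon\in(0,M\mu)$ a system is given. In each slot a finite list of jobs with integer sizes in $\{1,\dots,D_{\max}\}$ arrives, i.i.d. across slots; its overall size $a^{(\epsilon)}$ satisfies $a^{(\epsilon)}\le A_{\max}$ almost surely ($D_{\max},A_{\max}$ not depending on $\epsilon$), $\Pr(a^{(\epsilon)}=0)>0$, $\mathbb E[a^{(\epsilon)}]=\lambda^{(\epsilon)}=M\mu-\epsilon$, and $(\sigma^{(\epsilon)})^2:=\operatorname{var}(a^{(\epsilon)})\to\sigma^2$ as $\epsilon\downarrow0$. Let $q_m$ be the total remaining size of the jobs at server $m$. In each slot a pair of distinct servers is chosen uniformly at random, independently of the past and of the arrivals; all arrivals of the slot join the one with the smaller $q_m$, ties being broken uniformly at random. Then each server serves $\mu$ of its jobs for one unit (all its jobs if there are fewer than $\mu$); which jobs are served is decided by an arbitrary fixed, possibly randomized, preemptive rule depending on the current lists of remaining job sizes. These lists form a Markov chain. Let $\mathbf c_1=\frac1{\sqrt M}(1,\dots,1)$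 and $\mathbf q_\perp=\mathbf q-\langle\mathbf q,\mathbf c_1\rangle\mathbf c_1$. Let $\phi(t+1)=\max\{\phi(t)+a^{(\epsilon)}(t)-M\mu,\,0\}$ be the single-server queue with the same arrivals and service $M\mu$. *Claim.* For every $\epsilon\in(0,M\mu)$ both chains have a unique stationary distribution; write $\overline{\mathbf q}^{(\epsilon)}$, $\overline\phi^{(\epsilon)}$ for the queue lengths in steady state. Their means are finite, and: 1. (State-space collapse and upper bound) There are finite constants $N_r$, $r=1,2,\dots$, not depending on $\epsilon$, with $\mathbb E\big[\|\overline{\mathbf q}^{(\epsilon)}_\perp\|^r\big]\le N_r$ for all $r\ge 1$ and all $\epsilon\in(0,M\mu)$, and $$\mathbb E\Big[\sum_m\overline q_m^{(\epsilon)}\Big]\le\frac{(\sigma^{(\epsilon)})^2+\epsilon^2}{2\epsilon}+M\sqrt{\frac{N_2\,\mu}{\epsilon}}+M D_{\max}\mu .$$ 2. (Lower bound) For all $\epsilon\in(0,M\mu)$, $$\frac{(\sigma^{(\epsilon)})^2+\epsilon^2}{2\epsilon}-\frac{M\mu}{2}\le\mathbb E\big[\overline\phi^{(\epsilon)}\big]\le\mathbb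 E\Big[\sum_m\overline q_m^{(\epsilon)}\Big].$$ 3. (Heavy-traffic optimality) $\displaystyle\lim_{\epsilon\downarrow0}\epsilon\,\mathbb E\Big[\sum_m\overline q_m^{(\epsilon)}\Big]=\frac{\sigma^2}{2}=\lim_{\epsilon\downarrow0}\epsilon\,\mathbb E\big[\overline\phi^{(\epsilon)}\big].$ -/

import Mathlib

open MeasureTheory ProbabilityTheory Filter Topology

namespace PowerOfTwo

/-- Lists of job sizes form a countable set; it carries the discrete σ-algebra. -/
instance instMeasurableSpaceJobs : MeasurableSpace (List ℕ) := ⊤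

instance instDiscreteMeasurableSpaceJobs : DiscreteMeasurableSpace (List ℕ) :=
  ⟨fun _ => trivial⟩

/-- The state of the system: for every server, the list of the remaining sizes
(in time slots of service) of the jobs that wait at this server. -/
abbrev State (M : ℕ) := Fin M → List ℕ

/-- The queue length `q_m`: the total backlogged job size at server `m`. -/
def queueLength {M : ℕ} (Y : State M) (m : Fin M) : ℕ := (Y m).sum

/-- The total queue length `∑ m, q_m`. -/
noncomputable def totalQueue {M : ℕ} (Y : State M) : ℝ := ∑ m, (queueLength Y m : ℝ)

/-- The vector `q = (q_1, …, q_M)` in Euclidean space. -/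
noncomputable def queueVec {M : ℕ} (Y : State M) : EuclideanSpace ℝ (Fin M) :=
  WithLp.toLp 2 fun m => (queueLength Y m : ℝ)

/-- The unit vector `c₁ = (1, …, 1) / √M`, the direction of equal queues. -/
noncomputable def c1 (M : ℕ) : EuclideanSpace ℝ (Fin M) :=
  WithLp.toLp 2 fun _ => 1 / Real.sqrt M

/-- The component `Q_⊥ = Q - ⟨Q, c₁⟩ c₁` of `Q` perpendicular to `c₁`. -/
noncomputable def perp {M : ℕ} (Q : EuclideanSpace ℝ (Fin M)) : EuclideanSpace ℝ (Fin M) :=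
  Q - (inner ℝ Q (c1 M)) • c1 M

/-! Arrivals: the law of the list of the sizes of the jobs that arrive in one time slot. -/

/-- The overall size `a` of an arriving list of jobs. -/
def workload (A : List ℕ) : ℝ := (A.sum : ℝ)

/-- `λ = E[a]`. -/
noncomputable def arrivalRate (p : PMF (List ℕ)) : ℝ := ∫ A, workload A ∂p.toMeasure

/-- `σ² = var[a]`. -/
noncomputable def arrivalVar (p : PMF (List ℕ)) : ℝ := variance workload p.toMeasure

/-! Routing. -/

/-- The pairs `(m, m')` of servers with `m < m'`. -/
def serverPairs (M : ℕ) : Finset (Fin M × Fin M) := Finset.univ.filter fun p => p.1 < p.2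

theorem serverPairs_nonempty {M : ℕ} (hM : 2 ≤ M) : (serverPairs M).Nonempty :=
  ⟨(⟨0, by omega⟩, ⟨1, by omega⟩), by simp [serverPairs]⟩

/-- The two servers sampled in a time slot: a uniformly distributed pair. -/
noncomputable def samplePair {M : ℕ} (hM : 2 ≤ M) : PMF (Fin M × Fin M) :=
  PMF.uniformOfFinset (serverPairs M) (serverPairs_nonempty hM)

/-- The server among the two sampled ones that has the smaller queue length; ties are broken
uniformly at random. -/
noncomputable def shorterQueue {M : ℕ} (Y : State M) (p : Fin M × Fin M) : PMF (Fin M) :=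
  if queueLength Y p.1 < queueLength Y p.2 then PMF.pure p.1
  else if queueLength Y p.2 < queueLength Y p.1 then PMF.pure p.2
  else PMF.uniformOfFinset {p.1, p.2} ⟨p.1, by simp⟩

/-- All jobs of the list `A` join server `m`. -/
def addJobs {M : ℕ} (Y : State M) (m : Fin M) (A : List ℕ) : State M :=
  Function.update Y m (Y m ++ A)

/-! Service. -/

/-- The jobs in the positions `S` of a queue receive one time slot of service each;
finished jobs leave. -/
def serveQueue (l : List ℕ) (S : Finset ℕ) : List ℕ :=
  (l.mapIdx fun i d => if i ∈ S then d - 1 else d).filter fun d => 0 < d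

/-- One time slot of service at all servers. -/
def serveAll {M : ℕ} (Y : State M) (S : Fin M → Finset ℕ) : State M :=
  fun m => serveQueue (Y m) (S m)

/-- A (possibly randomized, preemptive) service rule chooses, given the jobs present, the
positions of the jobs that are served at each server. It is admissible for the service amount `μ`
if every server serves `μ` different jobs, or all its jobs if there are fewer than `μ`.
(A job cannot receive more than one unit of service in a time slot.) -/
def IsServiceRule {M : ℕ} (μ : ℕ) (rule : State M → PMF (Fin M → Finset ℕ)) : Prop :=
  ∀ Y, ∀ S ∈ (rule Y).support, ∀ m,
    S m ⊆ Finset.range (Y m).length ∧ (S m).card = min μ (Y m).length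

/-- The transition law of the Markov chain under power-of-two-choices routing: sample the arrivals
and, independently, two servers; route all arrivals to the shorter one of the two queues; serve. -/
noncomputable def po2Step {M : ℕ} (hM : 2 ≤ M) (arr : PMF (List ℕ))
    (rule : State M → PMF (Fin M → Finset ℕ)) (Y : State M) : PMF (State M) :=
  arr.bind fun A => (samplePair hM).bind fun p => (shorterQueue Y p).bind fun m =>
    (rule (addJobs Y m A)).map (serveAll (addJobs Y m A))

/-- The transition law of the single-server queue `φ(t+1) = max (φ(t) + a(t) - c) 0` with service
`c` in every time slot (the subtraction is the truncated one of natural numbers). -/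
noncomputable def singleStep (c : ℕ) (arr : PMF (List ℕ)) (φ : ℕ) : PMF ℕ :=
  arr.map fun A => φ + A.sum - c

/-- `π` is a steady-state (stationary) distribution of the Markov chain with transition law
`step`. -/
def IsSteadyState {α : Type*} (step : α → PMF α) (π : PMF α) : Prop := π.bind step = π

end PowerOfTwo

namespace PowerOfTwo

open scoped ENNReal

/-! ### Countable Markov chains: uniqueness and existence of stationary laws -/

section Markov

variable {α β : Type*}

/-! The proof is Lyapunov drift analysis in which the unused service is controlled by state-space
collapse. Joining the shorter of two sampled queues puts the work, on average, into a queue below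
the mean length by at least `‖q_⊥‖ / (2M)` (`integral_routeLaw_le`). Service has no effect on `q_⊥`
except for unused units, and these occur only at queues of length at most `μ * D`. So, where it is
large, `‖q_⊥‖` has a negative drift governed by the arrival rate and not by the slack `ε`
(`perp_drift`). Bounded increments turn this into an exponential moment independent of `ε`. For
small arrival rates `‖q‖` itself has a uniformly negative drift and dominates `‖q_⊥‖`. For each
fixed `ε` the drift of `‖q‖` (`norm_drift`) gives existence of the stationary law and all its
moments; uniqueness holds because the empty state is reachable from everywhere.

For the upper bound, test stationarity on a quadratic in the total queue `T`. The squares cancel and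
leave `2 * ε * E[T]` against the variance and the cross term of `T` with the unused service. Since
service is wasted only at short queues, `T` is there comparable to `‖q_⊥‖`, and a weighted AM-GM
inequality makes the cross term of order `√ε` (`QueueStep.sq_sum_le`). Dividing by `ε` costs `1/√ε`,
negligible against `1/ε`.

The lower bound combines a quadratic test function for the single-server queue
(`le_integral_single`) with stochastic domination (`tsum_chainLaw_single_le`): the pooled server
never wastes more service than the separate ones. -/

theorem tsum_bind_mul (p : PMF α) (k : α → PMF β) (f : β → ℝ≥0∞) :
    ∑' y, (p.bind k) y * f y = ∑' x, p x * ∑' y, k x y * f y := by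
  simp only [PMF.bind_apply, ← ENNReal.tsum_mul_right, ← ENNReal.tsum_mul_left]
  rw [ENNReal.tsum_comm]
  simp only [mul_assoc]

theorem eq_of_le_of_tsum_eq {f g : α → ℝ≥0∞} (h : ∀ a, f a ≤ g a) (hg : ∑' a, g a ≠ ∞)
    (hfg : ∑' a, g a ≤ ∑' a, f a) : f = g := by
  funext a
  by_contra hne
  exact absurd (ENNReal.tsum_lt_tsum (ne_top_of_le_ne_top hg (ENNReal.tsum_le_tsum h)) h
    (lt_of_le_of_ne (h a) hne)) (not_lt.2 hfg)

theorem tsum_step_mass (step : α → PMF α) (m : α → ℝ≥0∞) :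
    ∑' y, ∑' x, m x * step x y = ∑' x, m x := by
  rw [ENNReal.tsum_comm]
  simp [ENNReal.tsum_mul_left]

/-- An invariant measure below a stationary distribution that agrees with it at one point
agrees with it at all points from which this point can be reached. -/
theorem eq_of_reachable {step : α → PMF α} {m : α → ℝ≥0∞} {π : PMF α}
    (hm : ∀ y, ∑' x, m x * step x y = m y) (hπ : IsSteadyState step π) (hle : ∀ y, m y ≤ π y)
    {x y : α} (hxy : Relation.ReflTransGen (fun x y => y ∈ (step x).support) x y)
    (hy : m y = π y) : m x = π x := by
  induction hxy using Relation.ReflTransGen.head_induction_on with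
  | refl => exact hy
  | @head a c hac _ ih =>
    -- Termwise `m ≤ π`, and both sums equal the same finite mass at `c`, so all terms agree. In the
    -- term of `a` the factor `step a c` is nonzero and cancels.
    have hsum : (fun x => m x * step x c) = fun x => π x * step x c := by
      have hb : ∑' x, π x * step x c = π c := by
        conv_rhs => rw [← hπ, PMF.bind_apply]
      refine eq_of_le_of_tsum_eq (fun x => by gcongr; exact hle x) ?_ ?_
      · rw [hb]; exact π.apply_ne_top c
      · rw [hb, hm, ih]
    have := congrFun hsum a
    exact (ENNReal.mul_left_inj ((PMF.mem_support_iff _ _).1 hac)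
      ((step a).apply_ne_top c)).1 this

/-- A Markov chain with a state that can be reached from everywhere has at most one
stationary distribution. -/
theorem IsSteadyState.unique {step : α → PMF α} {x₀ : α}
    (hreach : ∀ x, Relation.ReflTransGen (fun x y => y ∈ (step x).support) x x₀)
    {π₁ π₂ : PMF α} (h₁ : IsSteadyState step π₁) (h₂ : IsSteadyState step π₂) : π₁ = π₂ := by
  set m : α → ℝ≥0∞ := fun x => min (π₁ x) (π₂ x) with hmdef
  have hb : ∀ π : PMF α, IsSteadyState step π → ∀ y, ∑' x, π x * step x y = π y := by
    intro π hπ y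
    conv_rhs => rw [← hπ, PMF.bind_apply]
  have hle₁ : ∀ y, m y ≤ π₁ y := fun y => min_le_left _ _
  have hle₂ : ∀ y, m y ≤ π₂ y := fun y => min_le_right _ _
  have hmass : ∑' x, m x ≠ ∞ :=
    ne_top_of_le_ne_top π₁.tsum_coe_ne_top (ENNReal.tsum_le_tsum hle₁)
  -- The minimum of two stationary laws can only decrease under a step; as mass is preserved, it is
  -- invariant.
  have hm : (fun y => ∑' x, m x * step x y) = m := by
    refine eq_of_le_of_tsum_eq (fun y => le_min ?_ ?_) hmass (tsum_step_mass step m).ge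
    · rw [← hb π₁ h₁ y]
      exact ENNReal.tsum_le_tsum fun x => by gcongr; exact hle₁ x
    · rw [← hb π₂ h₂ y]
      exact ENNReal.tsum_le_tsum fun x => by gcongr; exact hle₂ x
  have key : ∀ π : PMF α, IsSteadyState step π → (∀ y, m y ≤ π y) → m x₀ = π x₀ →
      ∀ x, m x = π x := fun π hπ hle h0 x =>
    eq_of_reachable (congrFun hm) hπ hle (hreach x) h0
  -- The law with the smaller mass at `x₀` agrees with `m` there, hence everywhere. So it lies below
  -- the other law, which has the same mass.
  rcases le_total (π₁ x₀) (π₂ x₀) with h | h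
  · have h1 := key π₁ h₁ hle₁ (min_eq_left h)
    refine DFunLike.coe_injective (eq_of_le_of_tsum_eq (fun x => ?_) π₂.tsum_coe_ne_top ?_)
    · rw [← h1 x]; exact hle₂ x
    · rw [π₁.tsum_coe, π₂.tsum_coe]
  · have h1 := key π₂ h₂ hle₂ (min_eq_right h)
    refine (DFunLike.coe_injective
      (eq_of_le_of_tsum_eq (fun x => ?_) π₁.tsum_coe_ne_top ?_)).symm
    · rw [← h1 x]; exact hle₁ x
    · rw [π₁.tsum_coe, π₂.tsum_coe]

/-- The law of the Markov chain at time `n` when it starts in `x₀`. -/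
noncomputable def chainLaw (step : α → PMF α) (x₀ : α) : ℕ → PMF α
  | 0 => PMF.pure x₀
  | n + 1 => (chainLaw step x₀ n).bind step

/-- The average of the laws of the chain at the times `0, …, n`. -/
noncomputable def averageLaw (step : α → PMF α) (x₀ : α) (n : ℕ) (y : α) : ℝ≥0∞ :=
  ((n : ℝ≥0∞) + 1)⁻¹ * ∑ i ∈ Finset.range (n + 1), chainLaw step x₀ i y

theorem tsum_averageLaw_mul (step : α → PMF α) (x₀ : α) (n : ℕ) (f : α → ℝ≥0∞) :
    ∑' y, averageLaw step x₀ n y * f y =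
      ((n : ℝ≥0∞) + 1)⁻¹ * ∑ i ∈ Finset.range (n + 1), ∑' y, chainLaw step x₀ i y * f y := by
  simp only [averageLaw, mul_assoc, ENNReal.tsum_mul_left, Finset.sum_mul]
  rw [Summable.tsum_finsetSum fun _ _ => ENNReal.summable]

theorem inv_mul_sum_const_le (n : ℕ) (C : ℝ≥0∞) :
    ((n : ℝ≥0∞) + 1)⁻¹ * ∑ _i ∈ Finset.range (n + 1), C = C := by
  rw [Finset.sum_const, Finset.card_range, nsmul_eq_mul, ← mul_assoc]
  push_cast
  rw [ENNReal.inv_mul_cancel (by simp) (by finiteness), one_mul]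

theorem tsum_averageLaw_mul_le {step : α → PMF α} {x₀ : α} {f : α → ℝ≥0∞} {C : ℝ≥0∞}
    (h : ∀ n, ∑' y, chainLaw step x₀ n y * f y ≤ C) (n : ℕ) :
    ∑' y, averageLaw step x₀ n y * f y ≤ C := by
  rw [tsum_averageLaw_mul]
  calc _ ≤ ((n : ℝ≥0∞) + 1)⁻¹ * ∑ _i ∈ Finset.range (n + 1), C := by
        gcongr with i; exact h i
    _ = C := inv_mul_sum_const_le n C

theorem tsum_averageLaw (step : α → PMF α) (x₀ : α) (n : ℕ) :
    ∑' y, averageLaw step x₀ n y = 1 := by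
  have := tsum_averageLaw_mul step x₀ n 1
  simp only [Pi.one_apply, mul_one, PMF.tsum_coe] at this
  rw [this, inv_mul_sum_const_le]

/-- A step shifts the time window by one, so the only mass gained is that of the new last time, at
most `1`. -/
theorem tsum_averageLaw_step_le (step : α → PMF α) (x₀ : α) (n : ℕ) (y : α) :
    ∑' x, averageLaw step x₀ n x * step x y ≤
      averageLaw step x₀ n y + ((n : ℝ≥0∞) + 1)⁻¹ := by
  rw [tsum_averageLaw_mul step x₀ n fun x => step x y, averageLaw]
  have h : ∀ i, ∑' x, chainLaw step x₀ i x * step x y = chainLaw step x₀ (i + 1) y :=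
    fun i => rfl
  simp only [h]
  calc _ ≤ ((n : ℝ≥0∞) + 1)⁻¹ *
        (∑ i ∈ Finset.range (n + 1), chainLaw step x₀ i y + 1) := by
        gcongr
        calc _ ≤ ∑ i ∈ Finset.range (n + 2), chainLaw step x₀ i y := by
              rw [Finset.sum_range_succ' _ (n + 1)]; exact le_self_add
          _ ≤ _ := by
              rw [Finset.sum_range_succ _ (n + 1)]
              gcongr
              exact PMF.coe_le_one _ _
    _ = _ := by rw [mul_add, mul_one]

/-- A Markov chain started in `x₀` along which the expectation of a function with finite
sublevel sets stays bounded has a stationary distribution; bounds on expectations that hold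
uniformly in time carry over to it. -/
theorem exists_steadyState (step : α → PMF α) (x₀ : α) (V : α → ℝ≥0∞)
    (hfin : ∀ k : ℕ, {x | V x ≤ k}.Finite) (C : ℝ≥0∞) (hC : C ≠ ∞)
    (hV : ∀ n, ∑' y, chainLaw step x₀ n y * V y ≤ C) :
    ∃ π : PMF α, IsSteadyState step π ∧ ∀ (f : α → ℝ≥0∞) (D : ℝ≥0∞),
      (∀ n, ∑' y, chainLaw step x₀ n y * f y ≤ D) → ∑' y, π y * f y ≤ D := by
  classical
  set U : Ultrafilter ℕ := hyperfilter ℕ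
  have hU : (U : Filter ℕ) ≤ atTop := Nat.hyperfilter_le_atTop
  -- A single ultrafilter serves all states at once, in place of a diagonal subsequence; `[0, ∞]` is
  -- compact.
  have hlim : ∀ y, ∃ l, Tendsto (fun n => averageLaw step x₀ n y) U (𝓝 l) := by
    intro y
    obtain ⟨l, -, hl⟩ := isCompact_univ.ultrafilter_le_nhds
      (U.map fun n => averageLaw step x₀ n y) (by simp)
    exact ⟨l, hl⟩
  choose l hl using hlim
  have hbound : ∀ (f : α → ℝ≥0∞) (D : ℝ≥0∞),
      (∀ n, ∑' y, chainLaw step x₀ n y * f y ≤ D) → ∑' y, l y * f y ≤ D := by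
    intro f D hD
    -- Multiplication is discontinuous at `(0, ∞)`, so values of `f` where `l` vanishes are
    -- discarded before passing to the limit.
    set g : α → ℝ≥0∞ := fun y => if l y = 0 then 0 else f y with hg
    have hgf : ∀ y, l y * f y = l y * g y := by
      intro y
      by_cases h : l y = 0 <;> simp [hg, h]
    simp only [hgf]
    rw [ENNReal.tsum_eq_iSup_sum]
    refine iSup_le fun F => ?_
    have ht : Tendsto (fun n => ∑ y ∈ F, averageLaw step x₀ n y * g y) U
        (𝓝 (∑ y ∈ F, l y * g y)) := by
      refine tendsto_finsetSum _ fun y _ => ?_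
      by_cases h : l y = 0
      · simp [hg, h]
      · exact ENNReal.Tendsto.mul_const (hl y) (Or.inl h)
    refine le_of_tendsto' ht fun n => (ENNReal.sum_le_tsum F).trans ?_
    refine le_trans (ENNReal.tsum_le_tsum fun y => ?_) (tsum_averageLaw_mul_le hD n)
    gcongr
    simp only [hg]
    split_ifs <;> simp
  have hle1 : ∑' y, l y ≤ 1 := by
    simpa using hbound 1 1 fun n => by simp
  have hge1 : 1 ≤ ∑' y, l y := by
    -- Tightness: by Markov's inequality the mass outside the finite set `V ≤ k + 1` is at most `C /
    -- (k + 1)`.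
    have hk : ∀ k : ℕ, 1 ≤ ∑' y, l y + C / (k + 1 : ℕ) := by
      intro k
      set F := (hfin (k + 1)).toFinset
      have ht : Tendsto (fun n => ∑ y ∈ F, averageLaw step x₀ n y + C / (k + 1 : ℕ)) U
          (𝓝 (∑ y ∈ F, l y + C / (k + 1 : ℕ))) :=
        (tendsto_finsetSum _ fun y _ => hl y).add tendsto_const_nhds
      refine (ge_of_tendsto' ht fun n => ?_).trans
        (add_le_add_left (ENNReal.sum_le_tsum F) _)
      calc (1 : ℝ≥0∞) = ∑' y, averageLaw step x₀ n y := (tsum_averageLaw step x₀ n).symm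
        _ ≤ ∑' y, ((F : Set α).indicator (averageLaw step x₀ n) y +
              averageLaw step x₀ n y * V y / (k + 1 : ℕ)) := by
            refine ENNReal.tsum_le_tsum fun y => ?_
            by_cases hy : y ∈ F
            · rw [Set.indicator_of_mem (by exact_mod_cast hy)]; exact le_self_add
            · refine le_trans ?_ le_add_self
              have : ((k + 1 : ℕ) : ℝ≥0∞) ≤ V y := by
                simp only [F, Set.Finite.mem_toFinset, Set.mem_ofPred_eq, not_le] at hy
                exact_mod_cast hy.le
              rw [mul_div_assoc]
              refine le_mul_of_one_le_right (zero_le) ?_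
              rw [ENNReal.le_div_iff_mul_le (by simp) (Or.inl (by finiteness)), one_mul]
              exact this
        _ = ∑ y ∈ F, averageLaw step x₀ n y +
              (∑' y, averageLaw step x₀ n y * V y) / (k + 1 : ℕ) := by
            rw [ENNReal.tsum_add]
            congr 1
            · exact (sum_eq_tsum_indicator _ _).symm
            · simp only [div_eq_mul_inv, ENNReal.tsum_mul_right]
        _ ≤ _ := by
            gcongr
            exact tsum_averageLaw_mul_le hV n
    have ht : Tendsto (fun k : ℕ => ∑' y, l y + C / (k + 1 : ℕ)) atTop
        (𝓝 (∑' y, l y + 0)) := by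
      refine tendsto_const_nhds.add ?_
      have h0 : Tendsto (fun k : ℕ => C / (k : ℝ≥0∞)) atTop (𝓝 0) := by
        have := ENNReal.Tendsto.const_mul (a := C) ENNReal.tendsto_inv_nat_nhds_zero (Or.inr hC)
        simpa [div_eq_mul_inv] using this
      exact h0.comp (tendsto_add_atTop_nat 1)
    simpa using ge_of_tendsto' ht hk
  have hsum : ∑' y, l y = 1 := le_antisymm hle1 hge1
  refine ⟨⟨l, hsum ▸ ENNReal.summable.hasSum⟩, ?_, hbound⟩
  -- Finite partial sums pass to the limit and give only an inequality, as in Fatou's lemma;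
  -- equality of total masses upgrades it.
  have hstep : ∀ y, ∑' x, l x * step x y ≤ l y := by
    intro y
    rw [ENNReal.tsum_eq_iSup_sum]
    refine iSup_le fun F => ?_
    have h1 : Tendsto (fun n => ∑ x ∈ F, averageLaw step x₀ n x * step x y) U
        (𝓝 (∑ x ∈ F, l x * step x y)) :=
      tendsto_finsetSum _ fun x _ =>
        ENNReal.Tendsto.mul_const (hl x) (Or.inr ((step x).apply_ne_top y))
    have h2 : Tendsto (fun n : ℕ => averageLaw step x₀ n y + ((n : ℝ≥0∞) + 1)⁻¹) U
        (𝓝 (l y + 0)) := by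
      refine (hl y).add (Tendsto.mono_left ?_ hU)
      have := ENNReal.tendsto_inv_nat_nhds_zero.comp (tendsto_add_atTop_nat 1)
      simpa [Function.comp_def] using this
    rw [add_zero] at h2
    exact le_of_tendsto_of_tendsto' h1 h2 fun n =>
      (ENNReal.sum_le_tsum F).trans (tsum_averageLaw_step_le step x₀ n y)
  have := eq_of_le_of_tsum_eq hstep (by rw [hsum]; simp) (tsum_step_mass step l).ge
  exact PMF.ext fun y => congrFun this y

theorem tsum_chainLaw_mul_le {step : α → PMF α} {x₀ : α} {V : α → ℝ≥0∞} {ρ K B : ℝ≥0∞}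
    (hdrift : ∀ x, ∑' y, step x y * V y ≤ ρ * V x + K) (h₀ : V x₀ ≤ B) (hB : ρ * B + K ≤ B)
    (n : ℕ) : ∑' y, chainLaw step x₀ n y * V y ≤ B := by
  induction n with
  | zero =>
    rw [tsum_eq_single x₀ fun y hy => by simp [chainLaw, hy]]
    simpa [chainLaw] using h₀
  | succ n ih =>
    rw [chainLaw, tsum_bind_mul]
    calc _ ≤ ∑' x, chainLaw step x₀ n x * (ρ * V x + K) :=
          ENNReal.tsum_le_tsum fun x => by gcongr; exact hdrift x
      _ = ρ * (∑' x, chainLaw step x₀ n x * V x) + K := by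
          simp only [mul_add, ENNReal.tsum_add, ENNReal.tsum_mul_right, PMF.tsum_coe, one_mul,
            ← ENNReal.tsum_mul_left]
          congr 1
          exact tsum_congr fun x => by ring
      _ ≤ ρ * B + K := by gcongr
      _ ≤ B := hB

end Markov

/-! ### Integrals against discrete laws; exponential moments from drift -/

section Integrals

variable {α β : Type*} [MeasurableSpace α] [MeasurableSpace β] [DiscreteMeasurableSpace α]

theorem lintegral_toMeasure [Countable α] (p : PMF α) (f : α → ℝ≥0∞) :
    ∫⁻ x, f x ∂p.toMeasure = ∑' x, p x * f x := by
  rw [lintegral_countable']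
  exact tsum_congr fun x => by
    rw [PMF.toMeasure_apply_singleton _ _ (MeasurableSet.singleton x), mul_comm]

theorem ae_toMeasure {p : PMF α} {P : α → Prop} (h : ∀ x ∈ p.support, P x) :
    ∀ᵐ x ∂p.toMeasure, P x := by
  rw [ae_iff, PMF.toMeasure_apply_eq_zero_iff _ (MeasurableSet.of_discrete)]
  exact Set.disjoint_left.2 fun x hx hx' => hx' (h x hx)

theorem ae_toMeasure_iff {p : PMF α} {P : α → Prop} :
    (∀ᵐ x ∂p.toMeasure, P x) ↔ ∀ x ∈ p.support, P x := by
  refine ⟨fun h x hx => ?_, ae_toMeasure⟩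
  rw [ae_iff, PMF.toMeasure_apply_eq_zero_iff _ (MeasurableSet.of_discrete)] at h
  by_contra hn
  exact Set.disjoint_left.1 h hx hn

theorem integrable_of_bounded {p : PMF α} {f : α → ℝ} {C : ℝ} (h : ∀ x ∈ p.support, |f x| ≤ C) :
    Integrable f p.toMeasure :=
  Integrable.of_bound (Measurable.of_discrete).aestronglyMeasurable C (ae_toMeasure h)

theorem toMeasure_bind [Countable α] (p : PMF α) (k : α → PMF β) :
    (p.bind k).toMeasure = p.toMeasure.bind fun x => (k x).toMeasure := by
  ext s hs
  rw [PMF.toMeasure_bind_apply _ _ _ hs,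
    Measure.bind_apply hs (Measurable.of_discrete).aemeasurable, lintegral_toMeasure]

/-- The law `p.bind k` is the composition of the kernel `k` with a constant kernel, so Fubini for
kernels applies. -/
theorem integral_bind [Countable α] {p : PMF α} {k : α → PMF β} {F : β → ℝ}
    (hF : Integrable F (p.bind k).toMeasure) :
    Integrable (fun x => ∫ y, F y ∂(k x).toMeasure) p.toMeasure ∧
    (∀ x ∈ p.support, Integrable F (k x).toMeasure) ∧
    ∫ y, F y ∂(p.bind k).toMeasure = ∫ x, ∫ y, F y ∂(k x).toMeasure ∂p.toMeasure := by
  let η : Kernel α β := ⟨fun x => (k x).toMeasure, Measurable.of_discrete⟩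
  have h : (p.bind k).toMeasure = (η ∘ₖ Kernel.const Unit p.toMeasure) () := by
    rw [Kernel.comp_apply, Kernel.const_apply, toMeasure_bind]; rfl
  rw [h] at hF
  refine ⟨by simpa using! hF.integral_comp, ?_, ?_⟩
  · have := ((integrable_comp_iff hF.aestronglyMeasurable).1 hF).1
    rw [Kernel.const_apply] at this
    exact ae_toMeasure_iff.1 this
  · rw [h, Kernel.integral_comp hF]; rfl

theorem integral_bind_le [Countable α] {p : PMF α} {k : α → PMF β} {F : β → ℝ} {G : α → ℝ}
    (hF : Integrable F (p.bind k).toMeasure) (hG : Integrable G p.toMeasure)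
    (h : ∀ x ∈ p.support, Integrable F (k x).toMeasure → ∫ y, F y ∂(k x).toMeasure ≤ G x) :
    ∫ y, F y ∂(p.bind k).toMeasure ≤ ∫ x, G x ∂p.toMeasure := by
  obtain ⟨h1, h2, h3⟩ := integral_bind hF
  rw [h3]
  exact integral_mono_ae h1 hG (ae_toMeasure fun x hx => h x hx (h2 x hx))

theorem integral_le_of_le {p : PMF α} {f : α → ℝ} {C : ℝ} (hf : Integrable f p.toMeasure)
    (h : ∀ x ∈ p.support, f x ≤ C) : ∫ x, f x ∂p.toMeasure ≤ C := by
  calc _ ≤ ∫ _x, C ∂p.toMeasure := integral_mono_ae hf (integrable_const _) (ae_toMeasure h)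
    _ = C := by simp

theorem tsum_mul_ofReal [Countable α] {p : PMF α} {f : α → ℝ} (hf : Integrable f p.toMeasure)
    (h0 : ∀ x, 0 ≤ f x) :
    ∑' x, p x * ENNReal.ofReal (f x) = ENNReal.ofReal (∫ x, f x ∂p.toMeasure) := by
  rw [ofReal_integral_eq_lintegral_ofReal hf (ae_of_all _ h0), lintegral_toMeasure]

/-- The exponential Lyapunov function of `Z` on the set `good`, infinite elsewhere. -/
noncomputable def expLyapunov (good : Set α) (Z : α → ℝ) (θ : ℝ) (x : α) : ℝ≥0∞ :=
  open Classical in if x ∈ good then ENNReal.ofReal (Real.exp (θ * Z x)) else ∞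

/-- A function with bounded increments and with drift at most `-δ` where it is at least `κ`:
its exponential contracts in expectation. -/
theorem exp_drift [Countable α] {step : α → PMF α} {good : Set α} {Z : α → ℝ} {B δ κ θ : ℝ}
    (hθ : 0 < θ) (hθB : θ * B ≤ 1) (hθδ : 2 * θ * B ^ 2 ≤ δ)
    (hgood : ∀ x ∈ good, ∀ y ∈ (step x).support, y ∈ good ∧ |Z y - Z x| ≤ B)
    (hdrift : ∀ x ∈ good, κ ≤ Z x → ∫ y, Z y ∂(step x).toMeasure ≤ Z x - δ) (hδ : θ * δ < 2)
    (x : α) :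
    ∑' y, step x y * expLyapunov good Z θ y ≤
      ENNReal.ofReal (1 - θ * δ / 2) * expLyapunov good Z θ x +
        ENNReal.ofReal (Real.exp (θ * (κ + B))) := by
  by_cases hx : x ∈ good
  swap
  · rw [expLyapunov, if_neg hx, ENNReal.mul_top (by simp; linarith), top_add]
    exact le_top
  have hZ : ∀ y ∈ (step x).support, |Z y| ≤ |Z x| + B := fun y hy => by
    have := (hgood x hx y hy).2
    have h2 := abs_sub_abs_le_abs_sub (Z y) (Z x)
    linarith
  have hZint : Integrable Z (step x).toMeasure := integrable_of_bounded hZ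
  have hexp : Integrable (fun y => Real.exp (θ * Z y)) (step x).toMeasure := by
    refine integrable_of_bounded (C := Real.exp (θ * (|Z x| + B))) fun y hy => ?_
    rw [Real.abs_exp, Real.exp_le_exp]
    gcongr
    exact (le_abs_self _).trans (hZ y hy)
  have hsum : ∑' y, step x y * expLyapunov good Z θ y =
      ENNReal.ofReal (∫ y, Real.exp (θ * Z y) ∂(step x).toMeasure) := by
    rw [← tsum_mul_ofReal hexp fun y => (Real.exp_pos _).le]
    refine tsum_congr fun y => ?_
    by_cases hy : y ∈ (step x).support
    · rw [expLyapunov, if_pos (hgood x hx y hy).1]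
    · rw [(PMF.apply_eq_zero_iff _ _).2 hy, zero_mul, zero_mul]
  rw [hsum, expLyapunov, if_pos hx]
  -- Above the level `κ` the contraction term suffices; below it the additive constant does, as one
  -- step raises `Z` by at most `B`.
  rcases le_or_gt κ (Z x) with hκ | hκ
  · refine le_add_right ?_
    rw [← ENNReal.ofReal_mul (by linarith)]
    refine ENNReal.ofReal_le_ofReal ?_
    have hint : Integrable (fun y => Real.exp (θ * Z x) *
        (1 + θ * (Z y - Z x) + (θ * B) ^ 2)) (step x).toMeasure := by fun_prop
    calc ∫ y, Real.exp (θ * Z y) ∂(step x).toMeasure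
        ≤ ∫ y, Real.exp (θ * Z x) * (1 + θ * (Z y - Z x) + (θ * B) ^ 2) ∂(step x).toMeasure := by
          refine integral_mono_ae hexp hint (ae_toMeasure fun y hy => ?_)
          have hB := (hgood x hx y hy).2
          have h1 : |θ * (Z y - Z x)| ≤ θ * B := by
            rw [abs_mul, abs_of_pos hθ]; gcongr
          have h2 := (abs_le.1 (Real.abs_exp_sub_one_sub_id_le (h1.trans hθB))).2
          have h3 : (θ * (Z y - Z x)) ^ 2 ≤ (θ * B) ^ 2 := sq_le_sq' (abs_le.1 h1).1 (abs_le.1 h1).2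
          have h4 : Real.exp (θ * Z y) = Real.exp (θ * Z x) * Real.exp (θ * (Z y - Z x)) := by
            rw [← Real.exp_add]; ring_nf
          simp only [h4]
          gcongr
          linarith
      _ = Real.exp (θ * Z x) * (1 + θ * (∫ y, Z y ∂(step x).toMeasure - Z x) + (θ * B) ^ 2) := by
          rw [integral_const_mul, integral_add (by fun_prop) (by fun_prop),
            integral_add (by fun_prop) (by fun_prop), integral_const_mul,
            integral_sub hZint (by fun_prop)]
          simp
      _ ≤ (1 - θ * δ / 2) * Real.exp (θ * Z x) := by
          rw [mul_comm]
          gcongr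
          -- The linear term contributes `-θδ`, and the quadratic error `(θB)²` uses up at most `θδ
          -- / 2` of it.
          have h1 := mul_le_mul_of_nonneg_left (hdrift x hx hκ) hθ.le
          have h2 := mul_le_mul_of_nonneg_left hθδ hθ.le
          nlinarith
  · refine le_add_left (ENNReal.ofReal_le_ofReal ?_)
    refine integral_le_of_le hexp fun y hy => ?_
    rw [Real.exp_le_exp]
    have := (abs_le.1 (hgood x hx y hy).2).2
    gcongr
    linarith

/-- Exponential moments along the chain are bounded in terms of the bound `B` on the increments
and of the drift parameters `δ`, `κ` alone. -/
theorem exists_exp_moment_bound (α : Type*) [MeasurableSpace α] [DiscreteMeasurableSpace α]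
    [Countable α] {B δ κ : ℝ} (hB : 0 < B) (hδ : 0 < δ) :
    ∃ θ : ℝ, 0 < θ ∧ ∃ C : ℝ, 0 < C ∧
      ∀ (step : α → PMF α) (good : Set α) (Z : α → ℝ) (x₀ : α), x₀ ∈ good → Z x₀ = 0 →
        (∀ x ∈ good, ∀ y ∈ (step x).support, y ∈ good ∧ |Z y - Z x| ≤ B) →
        (∀ x ∈ good, κ ≤ Z x → ∫ y, Z y ∂(step x).toMeasure ≤ Z x - δ) →
        ∀ n, ∑' y, chainLaw step x₀ n y * expLyapunov good Z θ y ≤ ENNReal.ofReal C := by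
  set θ := min (1 / B) (min (δ / (2 * B ^ 2)) (1 / δ)) with hθdef
  have hθ : 0 < θ := by positivity
  have h1 : θ * B ≤ 1 := by
    rw [← le_div_iff₀ hB]; exact min_le_left _ _
  have h2 : 2 * θ * B ^ 2 ≤ δ := by
    have : θ * (2 * B ^ 2) ≤ δ := by
      rw [← le_div_iff₀ (by positivity)]; exact (min_le_right _ _).trans (min_le_left _ _)
    linarith
  have h3 : θ * δ < 2 := by
    have : θ * δ ≤ 1 := by
      rw [← le_div_iff₀ hδ]; exact (min_le_right _ _).trans (min_le_right _ _)
    linarith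
  set K := Real.exp (θ * (κ + B))
  have hK : 0 < K := Real.exp_pos _
  -- `2K / (θδ)` is the fixed point of `r ↦ (1 - θδ/2) r + K`; the extra `1` covers the initial
  -- value `exp 0`.
  refine ⟨θ, hθ, 1 + 2 * K / (θ * δ), by positivity, ?_⟩
  intro step good Z x₀ hx₀ hZ₀ hgood hdrift n
  refine tsum_chainLaw_mul_le (exp_drift hθ h1 h2 hgood hdrift h3) ?_ ?_ n
  · rw [expLyapunov, if_pos hx₀, hZ₀]
    refine ENNReal.ofReal_le_ofReal ?_
    rw [mul_zero, Real.exp_zero]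
    have : 0 ≤ 2 * K / (θ * δ) := by positivity
    linarith
  · rw [← ENNReal.ofReal_mul (by linarith), ← ENNReal.ofReal_add
      (mul_nonneg (by linarith) (by positivity)) hK.le]
    refine ENNReal.ofReal_le_ofReal ?_
    have : (θ * δ / 2) * (2 * K / (θ * δ)) = K := by field_simp
    have h4 : 0 < θ * δ := by positivity
    nlinarith

end Integrals

/-! ### Service of a queue and the one-slot queue dynamics -/

section Service

theorem serveQueue_append_singleton (l : List ℕ) (e : ℕ) (S : Finset ℕ) :
    serveQueue (l ++ [e]) S =
      serveQueue l S ++ [if l.length ∈ S then e - 1 else e].filter fun d => 0 < d := by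
  simp [serveQueue, List.mapIdx_append]

theorem card_inter_range_succ (S : Finset ℕ) (n : ℕ) :
    (S ∩ Finset.range (n + 1)).card =
      (S ∩ Finset.range n).card + if n ∈ S then 1 else 0 := by
  rw [Finset.range_add_one]
  split_ifs with h
  · rw [Finset.inter_insert_of_mem h, Finset.card_insert_of_notMem (by simp)]
  · rw [Finset.inter_insert_of_notMem h, add_zero]

theorem sum_serveQueue (l : List ℕ) (S : Finset ℕ) (hl : ∀ d ∈ l, 1 ≤ d) :
    (serveQueue l S).sum + (S ∩ Finset.range l.length).card = l.sum := by
  induction l using List.reverseRecOn with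
  | nil => simp [serveQueue]
  | append_singleton l e ih =>
    have h1 := ih fun d hd => hl d (by simp [hd])
    have h2 : 1 ≤ e := hl e (by simp)
    rw [serveQueue_append_singleton, List.length_append, List.length_singleton,
      card_inter_range_succ, List.sum_append, List.sum_append, ← h1]
    by_cases h : l.length ∈ S
    · by_cases he : e = 1
      · simp [h, he]; omega
      · have : 0 < e - 1 := by omega
        simp [h, this]; omega
    · simp [h, show 0 < e by omega]; omega

/-- Counting the jobs along with their sizes makes every served position lower the weight, even for
jobs of size zero. Reachability from arbitrary states needs those too. -/
theorem weight_serveQueue_le (l : List ℕ) (S : Finset ℕ) :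
    (serveQueue l S).sum + (serveQueue l S).length + (S ∩ Finset.range l.length).card ≤
      l.sum + l.length := by
  induction l using List.reverseRecOn with
  | nil => simp [serveQueue]
  | append_singleton l e ih =>
    simp only [serveQueue_append_singleton, List.length_append, List.length_singleton,
      card_inter_range_succ, List.sum_append]
    by_cases h : l.length ∈ S
    · by_cases he : 0 < e - 1
      · simp [h, he]; omega
      · simp [h, he]; omega
    · by_cases he : 0 < e
      · simp [h, he]; omega
      · simp [h, he]; omega

theorem mem_serveQueue {l : List ℕ} {S : Finset ℕ} {D : ℕ} (hl : ∀ d ∈ l, 1 ≤ d ∧ d ≤ D)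
    {d : ℕ} (hd : d ∈ serveQueue l S) : 1 ≤ d ∧ d ≤ D := by
  simp only [serveQueue, List.mem_filter, decide_eq_true_eq, List.mem_mapIdx] at hd
  obtain ⟨⟨i, hi, rfl⟩, hpos⟩ := hd
  have := hl _ (List.getElem_mem hi)
  split_ifs at * <;> omega

/-- The states in which all jobs have a size in `{1, …, D}`. -/
def goodState (M D : ℕ) : Set (State M) := {Y | ∀ m, ∀ d ∈ Y m, 1 ≤ d ∧ d ≤ D}

/-- The effect of one time slot on the queue lengths, when `a` units of work arrive at
server `m`: there is some unused service `u`, which vanishes at long queues. -/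
def QueueStep {M : ℕ} (μ D : ℝ) (q q' : Fin M → ℝ) (m : Fin M) (a : ℝ) : Prop :=
  ∃ u : Fin M → ℝ, ∀ j, q' j = q j + (if j = m then a else 0) - μ + u j ∧ 0 ≤ u j ∧ u j ≤ μ ∧
    u j * q j ≤ u j * (μ * D) ∧ u j * q' j ≤ u j * (μ * D)

/-- The queue lengths as real numbers. -/
def realQueue {M : ℕ} (Y : State M) (m : Fin M) : ℝ := queueLength Y m

theorem addJobs_mem_goodState {M D : ℕ} {Y : State M} (hY : Y ∈ goodState M D) (m : Fin M)
    {A : List ℕ} (hA : ∀ d ∈ A, 1 ≤ d ∧ d ≤ D) : addJobs Y m A ∈ goodState M D := by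
  intro j d hd
  rcases eq_or_ne j m with rfl | h
  · simp only [addJobs, Function.update_self, List.mem_append] at hd
    exact hd.elim (hY j d) (hA d)
  · rw [addJobs, Function.update_of_ne h] at hd
    exact hY j d hd

theorem queueLength_addJobs {M : ℕ} (Y : State M) (m j : Fin M) (A : List ℕ) :
    queueLength (addJobs Y m A) j = queueLength Y j + if j = m then A.sum else 0 := by
  rcases eq_or_ne j m with rfl | h
  · simp [queueLength, addJobs]
  · simp [queueLength, addJobs, h]

theorem serveAll_mem_goodState {M D : ℕ} {Y : State M} (hY : Y ∈ goodState M D)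
    (S : Fin M → Finset ℕ) : serveAll Y S ∈ goodState M D :=
  fun m _ hd => mem_serveQueue (hY m) hd

theorem queueStep_serveAll {M μ D : ℕ} {Y : State M} (hY : Y ∈ goodState M D) (m : Fin M)
    {A : List ℕ} (hA : ∀ d ∈ A, 1 ≤ d ∧ d ≤ D) {S : Fin M → Finset ℕ}
    (hS : ∀ j, S j ⊆ Finset.range (addJobs Y m A j).length ∧
      (S j).card = min μ (addJobs Y m A j).length) :
    QueueStep μ D (realQueue Y) (realQueue (serveAll (addJobs Y m A) S)) m A.sum := by
  refine ⟨fun j => ((μ - (S j).card : ℕ) : ℝ), fun j => ?_⟩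
  have hgood := addJobs_mem_goodState hY m hA
  have hsum := sum_serveQueue (addJobs Y m A j) (S j) fun d hd => (hgood j d hd).1
  rw [Finset.inter_eq_left.2 (hS j).1] at hsum
  have hq := queueLength_addJobs Y m j A
  have hle : (S j).card ≤ μ := by rw [(hS j).2]; exact min_le_left _ _
  have hnat : queueLength (serveAll (addJobs Y m A) S) j + (S j).card =
      queueLength Y j + if j = m then A.sum else 0 := hsum.trans hq
  -- Service is wasted only if all jobs present are served; these are at most `μ` jobs of size at
  -- most `D`, which bounds the queue before and after the slot.
  have hsmall : (S j).card < μ → queueLength Y j ≤ μ * D ∧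
      queueLength (serveAll (addJobs Y m A) S) j ≤ μ * D := by
    intro hlt
    have hlen : (addJobs Y m A j).length ≤ μ := by
      have := (hS j).2; omega
    have h1 : (addJobs Y m A j).sum ≤ (addJobs Y m A j).length * D := by
      simpa using List.sum_le_card_nsmul _ D fun d hd => (hgood j d hd).2
    have h2 : (addJobs Y m A j).sum ≤ μ * D := h1.trans (Nat.mul_le_mul_right _ hlen)
    change queueLength (addJobs Y m A) j ≤ _ at h2
    omega
  have hreal : (queueLength (serveAll (addJobs Y m A) S) j : ℝ) + (S j).card =
      queueLength Y j + if j = m then (A.sum : ℝ) else 0 := by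
    have := congrArg (Nat.cast (R := ℝ)) hnat
    rwa [Nat.cast_add, Nat.cast_add, Nat.cast_ite, Nat.cast_zero] at this
  dsimp only
  refine ⟨?_, by positivity, Nat.cast_le.2 (Nat.sub_le _ _), ?_, ?_⟩
  · rw [Nat.cast_sub hle]
    simp only [realQueue]
    linarith
  all_goals
    rcases hle.lt_or_eq with hlt | heq
    · refine mul_le_mul_of_nonneg_left ?_ (by positivity)
      simp only [realQueue]
      first
        | exact_mod_cast (hsmall hlt).1
        | exact_mod_cast (hsmall hlt).2
    · simp [heq]

end Service

/-! ### The transition law and reachability of the empty system -/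

section Transition

variable {M : ℕ}

/-- Assumptions on the law of the arrivals in one time slot. -/
structure IsArrivalLaw (D Amax : ℕ) (p : PMF (List ℕ)) : Prop where
  size : ∀ A ∈ p.support, ∀ d ∈ A, 1 ≤ d ∧ d ≤ D
  bdd : ∀ A ∈ p.support, A.sum ≤ Amax
  nil_mem : [] ∈ p.support

theorem finite_lists_sum_le (K : ℕ) : {l : List ℕ | (∀ d ∈ l, 1 ≤ d) ∧ l.sum ≤ K}.Finite := by
  induction K with
  | zero =>
    refine (Set.finite_singleton ([] : List ℕ)).subset ?_
    rintro (_ | ⟨d, l⟩) ⟨h1, h2⟩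
    · rfl
    · have := h1 d (by simp)
      simp at h2; omega
  | succ K ih =>
    refine ((Set.finite_singleton ([] : List ℕ)).union
      (Set.Finite.image2 List.cons (Set.finite_Iic (K + 1)) ih)).subset ?_
    rintro (_ | ⟨d, l⟩) ⟨h1, h2⟩
    · exact Or.inl rfl
    · have := h1 d (by simp)
      simp only [List.sum_cons] at h2
      exact Or.inr ⟨d, by simp; omega, l, ⟨fun e he => h1 e (by simp [he]), by omega⟩, rfl⟩

theorem IsArrivalLaw.integrable {D Amax : ℕ} {p : PMF (List ℕ)} (hp : IsArrivalLaw D Amax p)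
    (f : List ℕ → ℝ) : Integrable f p.toMeasure := by
  have hfin : p.support.Finite := (finite_lists_sum_le Amax).subset fun A hA =>
    ⟨fun d hd => (hp.size A hA d hd).1, hp.bdd A hA⟩
  obtain ⟨C, hC⟩ := (hfin.image fun A => |f A|).bddAbove
  exact integrable_of_bounded fun A hA => hC ⟨A, hA, rfl⟩

/-- The law of the server that gets the arrivals. -/
noncomputable def routeLaw (hM : 2 ≤ M) (Y : State M) : PMF (Fin M) :=
  (samplePair hM).bind (shorterQueue Y)

theorem po2Step_eq (hM : 2 ≤ M) (arr : PMF (List ℕ)) (rule : State M → PMF (Fin M → Finset ℕ))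
    (Y : State M) : po2Step hM arr rule Y = arr.bind fun A => (routeLaw hM Y).bind fun m =>
      (rule (addJobs Y m A)).map (serveAll (addJobs Y m A)) := by
  simp [po2Step, routeLaw, PMF.bind_bind]

theorem mem_support_po2Step {hM : 2 ≤ M} {arr : PMF (List ℕ)}
    {rule : State M → PMF (Fin M → Finset ℕ)} {Y Y' : State M} :
    Y' ∈ (po2Step hM arr rule Y).support ↔ ∃ A ∈ arr.support, ∃ m ∈ (routeLaw hM Y).support,
      ∃ S ∈ (rule (addJobs Y m A)).support, serveAll (addJobs Y m A) S = Y' := by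
  simp only [po2Step_eq, PMF.mem_support_bind_iff, PMF.mem_support_map_iff]

variable {μ D Amax : ℕ} {hM : 2 ≤ M} {arr : PMF (List ℕ)}
  {rule : State M → PMF (Fin M → Finset ℕ)}

theorem po2Step_support (hrule : IsServiceRule μ rule) (harr : IsArrivalLaw D Amax arr)
    {Y : State M} (hY : Y ∈ goodState M D) {Y' : State M}
    (hY' : Y' ∈ (po2Step hM arr rule Y).support) :
    Y' ∈ goodState M D ∧ ∃ A ∈ arr.support, ∃ m,
      QueueStep μ D (realQueue Y) (realQueue Y') m A.sum := by
  obtain ⟨A, hA, m, -, S, hS, rfl⟩ := mem_support_po2Step.1 hY'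
  exact ⟨serveAll_mem_goodState (addJobs_mem_goodState hY m (harr.size A hA)) S, A, hA, m,
    queueStep_serveAll hY m (harr.size A hA) (hrule _ S hS)⟩

/-- This removes the service rule: a bound valid for every admissible outcome of service leaves only
the average over arrivals and the independent routing. -/
theorem integral_po2Step_le (hrule : IsServiceRule μ rule) (harr : IsArrivalLaw D Amax arr)
    {Y : State M} (hY : Y ∈ goodState M D) {F : State M → ℝ} {G : List ℕ → Fin M → ℝ}
    (hF : Integrable F (po2Step hM arr rule Y).toMeasure)
    (h : ∀ A ∈ arr.support, ∀ m, ∀ Y' ∈ goodState M D,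
      QueueStep μ D (realQueue Y) (realQueue Y') m A.sum → F Y' ≤ G A m) :
    ∫ Y', F Y' ∂(po2Step hM arr rule Y).toMeasure ≤
      ∫ A, ∫ m, G A m ∂(routeLaw hM Y).toMeasure ∂arr.toMeasure := by
  rw [po2Step_eq] at hF ⊢
  refine integral_bind_le hF (harr.integrable _) fun A hA hF1 => ?_
  refine integral_bind_le hF1 .of_finite fun m _ hF2 => ?_
  refine integral_le_of_le hF2 fun Y' hY' => ?_
  obtain ⟨S, hS, rfl⟩ := (PMF.mem_support_map_iff _ _ _).1 hY'
  exact h A hA m _ (serveAll_mem_goodState (addJobs_mem_goodState hY m (harr.size A hA)) S)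
    (queueStep_serveAll hY m (harr.size A hA) (hrule _ S hS))

/-- The empty system can be reached from every state. -/
theorem po2Step_reaches_empty (hμ : 0 < μ) (hrule : IsServiceRule μ rule)
    (harr : [] ∈ arr.support) (Y : State M) :
    Relation.ReflTransGen (fun Y Y' => Y' ∈ (po2Step hM arr rule Y).support) Y
      fun _ => [] := by
  -- In slots without arrivals the total of sizes and job counts strictly decreases until the system
  -- is empty.
  induction hn : ∑ m, ((Y m).sum + (Y m).length) using Nat.strong_induction_on generalizing Y with
  | _ n ih =>
    by_cases hY : Y = fun _ => []
    · rw [hY]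
    obtain ⟨m, hm⟩ := (routeLaw hM Y).support_nonempty
    have hadd : addJobs Y m [] = Y := by simp [addJobs]
    obtain ⟨S, hS⟩ := (rule Y).support_nonempty
    have hstep : serveAll Y S ∈ (po2Step hM arr rule Y).support :=
      mem_support_po2Step.2 ⟨[], harr, m, hm, S, by rwa [hadd], by rw [hadd]⟩
    refine Relation.ReflTransGen.head hstep (ih _ ?_ _ rfl)
    rw [← hn]
    have hw : ∀ j, (serveAll Y S j).sum + (serveAll Y S j).length + (S j).card ≤
        (Y j).sum + (Y j).length := fun j => by
      have := weight_serveQueue_le (Y j) (S j)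
      rwa [Finset.inter_eq_left.2 (hrule Y S hS j).1] at this
    obtain ⟨j, hj⟩ : ∃ j, Y j ≠ [] := by
      by_contra! hcon
      exact hY (funext hcon)
    refine Finset.sum_lt_sum (fun i _ => by have := hw i; omega) ⟨j, Finset.mem_univ j, ?_⟩
    have h1 := hw j
    have h2 := (hrule Y S hS j).2
    have h3 := List.length_pos_of_ne_nil hj
    omega

end Transition

/-! ### The component perpendicular to the diagonal -/

section Geometry

variable {M : ℕ}

theorem norm_sq_eq_sum (x : EuclideanSpace ℝ (Fin M)) : ‖x‖ ^ 2 = ∑ j, x j ^ 2 := by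
  simp [EuclideanSpace.norm_sq_eq]

theorem norm_le_sum_abs (x : EuclideanSpace ℝ (Fin M)) : ‖x‖ ≤ ∑ j, |x j| := by
  refine le_of_sq_le_sq ?_ (Finset.sum_nonneg fun j _ => abs_nonneg _)
  rw [norm_sq_eq_sum]
  simpa using Finset.sum_sq_le_sq_sum_of_nonneg (s := Finset.univ) (f := fun j => |x j|)
    fun j _ => abs_nonneg _

theorem abs_apply_le_norm (x : EuclideanSpace ℝ (Fin M)) (j : Fin M) : |x j| ≤ ‖x‖ := by
  simpa using PiLp.norm_apply_le x j

theorem perp_apply (x : EuclideanSpace ℝ (Fin M)) (j : Fin M) :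
    perp x j = x j - (∑ i, x i) / M := by
  have h : inner ℝ x (c1 M) = (∑ i, x i) / Real.sqrt M := by
    simp [c1, PiLp.inner_apply, div_eq_inv_mul, Finset.mul_sum]
  simp only [perp, PiLp.sub_apply, PiLp.smul_apply, h]
  simp only [c1, smul_eq_mul]
  rw [div_mul_div_comm, mul_one, Real.mul_self_sqrt (Nat.cast_nonneg M)]

theorem perp_sub (x y : EuclideanSpace ℝ (Fin M)) : perp (x - y) = perp x - perp y := by
  simp only [perp, inner_sub_left, sub_smul]
  abel

/-- The mean minimizes the sum of squared deviations. Hence the centre may be frozen at the old mean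
when `‖q_⊥‖` after a step is estimated. -/
theorem sum_sub_mean_sq_le (hM : 0 < M) (q : Fin M → ℝ) (c : ℝ) :
    ∑ j, (q j - (∑ i, q i) / M) ^ 2 ≤ ∑ j, (q j - c) ^ 2 := by
  have hM' : (M : ℝ) ≠ 0 := by positivity
  have h : ∀ c : ℝ, ∑ j, (q j - c) ^ 2 = ∑ j, q j ^ 2 - 2 * c * ∑ j, q j + M * c ^ 2 := by
    intro c
    simp only [sub_sq, Finset.sum_add_distrib, Finset.sum_sub_distrib, Finset.mul_sum]
    simp
    exact Finset.sum_congr rfl fun _ _ => by ring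
  rw [h, h]
  set s := ∑ i, q i
  have h2 : 0 ≤ M * (c - s / M) ^ 2 := by positivity
  have h3 : M * (c - s / M) ^ 2 = M * c ^ 2 - 2 * c * s + s ^ 2 / M := by field_simp; ring
  have h4 : - 2 * (s / M) * s + M * (s / M) ^ 2 = - (s ^ 2 / M) := by field_simp; ring
  linarith

theorem norm_perp_sq (x : EuclideanSpace ℝ (Fin M)) :
    ‖perp x‖ ^ 2 = ∑ j, (x j - (∑ i, x i) / M) ^ 2 := by
  simp only [norm_sq_eq_sum, perp_apply]

theorem norm_perp_le (hM : 0 < M) (x : EuclideanSpace ℝ (Fin M)) : ‖perp x‖ ≤ ‖x‖ := by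
  refine le_of_sq_le_sq ?_ (norm_nonneg _)
  rw [norm_perp_sq, norm_sq_eq_sum]
  simpa using sum_sub_mean_sq_le hM x 0

theorem abs_norm_perp_sub_le (hM : 0 < M) (x y : EuclideanSpace ℝ (Fin M)) :
    |‖perp x‖ - ‖perp y‖| ≤ ‖x - y‖ :=
  (abs_norm_sub_norm_le _ _).trans (perp_sub x y ▸ norm_perp_le hM (x - y))

theorem queueVec_apply (Y : State M) (j : Fin M) : queueVec Y j = realQueue Y j := rfl

theorem totalQueue_eq (Y : State M) : totalQueue Y = ∑ j, realQueue Y j := rfl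

theorem realQueue_nonneg (Y : State M) (j : Fin M) : 0 ≤ realQueue Y j := Nat.cast_nonneg _

theorem norm_queueVec_le (Y : State M) : ‖queueVec Y‖ ≤ totalQueue Y := by
  refine (norm_le_sum_abs _).trans_eq (Finset.sum_congr rfl fun j _ => ?_)
  rw [queueVec_apply, abs_of_nonneg (realQueue_nonneg Y j)]; rfl

theorem realQueue_le_norm (Y : State M) (j : Fin M) : realQueue Y j ≤ ‖queueVec Y‖ :=
  (le_abs_self _).trans (abs_apply_le_norm (queueVec Y) j)

theorem totalQueue_le (Y : State M) : totalQueue Y ≤ M * ‖queueVec Y‖ := by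
  rw [totalQueue_eq]
  refine (Finset.sum_le_sum fun j _ => realQueue_le_norm Y j).trans_eq ?_
  simp

theorem totalQueue_nonneg (Y : State M) : 0 ≤ totalQueue Y :=
  Finset.sum_nonneg fun j _ => realQueue_nonneg Y j

end Geometry

/-! ### The gain from sampling two queues -/

section Routing

variable {M : ℕ}

theorem sum_pairs_of_symm (f : Fin M → Fin M → ℝ) (hf : ∀ i j, f i j = f j i) :
    ∑ i, ∑ j, f i j = 2 * ∑ p ∈ serverPairs M, f p.1 p.2 + ∑ i, f i i := by
  have h1 : ∑ i, ∑ j, f i j = ∑ p : Fin M × Fin M, f p.1 p.2 :=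
    (Fintype.sum_prod_type' f).symm
  have hlt : ∑ p : Fin M × Fin M, (if p.1 < p.2 then f p.1 p.2 else 0) =
      ∑ p ∈ serverPairs M, f p.1 p.2 := by rw [serverPairs, Finset.sum_filter]
  have hgt : ∑ p : Fin M × Fin M, (if p.2 < p.1 then f p.1 p.2 else 0) =
      ∑ p ∈ serverPairs M, f p.1 p.2 := by
    rw [← hlt, ← (Equiv.prodComm (Fin M) (Fin M)).sum_comp]
    refine Finset.sum_congr rfl fun p _ => ?_
    simp [hf p.2 p.1]
  have heq : ∑ p : Fin M × Fin M, (if p.1 = p.2 then f p.1 p.2 else 0) = ∑ i, f i i := by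
    rw [Fintype.sum_prod_type]
    simp
  rw [h1, two_mul, ← heq]
  nth_rw 1 [← hlt]
  rw [← hgt, ← Finset.sum_add_distrib, ← Finset.sum_add_distrib]
  refine Finset.sum_congr rfl fun p _ => ?_
  rcases lt_trichotomy p.1 p.2 with h | h | h
  · simp [h, h.not_gt, h.ne]
  · simp [h]
  · simp [h, h.not_gt, h.ne']

theorem card_serverPairs (M : ℕ) : ((serverPairs M).card : ℝ) = M * (M - 1) / 2 := by
  have := sum_pairs_of_symm (M := M) (fun _ _ => (1 : ℝ)) fun _ _ => rfl
  simp at this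
  linarith

theorem sum_pairs_min (q : Fin M → ℝ) :
    ∑ p ∈ serverPairs M, min (q p.1) (q p.2) =
      ((M - 1) * ∑ i, q i - (∑ i, ∑ j, |q i - q j|) / 2) / 2 := by
  have h := sum_pairs_of_symm (fun i j => min (q i) (q j)) fun i j => min_comm _ _
  have h2 : ∑ i, ∑ j, min (q i) (q j) = M * ∑ i, q i - (∑ i, ∑ j, |q i - q j|) / 2 := by
    have hmin : ∀ a b : ℝ, min a b = (a + b - |a - b|) / 2 := fun a b => by
      rcases le_total a b with h | h
      · rw [min_eq_left h, abs_of_nonpos (by linarith)]; ring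
      · rw [min_eq_right h, abs_of_nonneg (by linarith)]; ring
    simp only [hmin, ← Finset.sum_div, Finset.sum_add_distrib, Finset.sum_sub_distrib]
    simp [← Finset.mul_sum]
    ring
  simp only [min_self] at h
  linarith

/-- `M` times a coordinate of `perp x` is the sum of its differences to all coordinates of `x`. -/
theorem norm_perp_le_sum_abs (hM : 0 < M) (x : EuclideanSpace ℝ (Fin M)) :
    M * ‖perp x‖ ≤ ∑ i, ∑ j, |x i - x j| := by
  have hM' : (0 : ℝ) < M := by positivity
  calc M * ‖perp x‖ ≤ M * ∑ i, |perp x i| := by gcongr; exact norm_le_sum_abs _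
    _ = ∑ i, |∑ j, (x i - x j)| := by
        rw [Finset.mul_sum]
        refine Finset.sum_congr rfl fun i _ => ?_
        rw [perp_apply, ← abs_of_pos hM', ← abs_mul, abs_of_pos hM', Finset.sum_sub_distrib]
        congr 1
        simp
        field_simp
    _ ≤ _ := Finset.sum_le_sum fun i _ => Finset.abs_sum_le_sum_abs _ _

theorem realQueue_of_mem_support_shorterQueue {Y : State M} {p : Fin M × Fin M} {m : Fin M}
    (h : m ∈ (shorterQueue Y p).support) :
    realQueue Y m = min (realQueue Y p.1) (realQueue Y p.2) := by
  unfold shorterQueue at h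
  unfold realQueue
  rw [← Nat.cast_min, Nat.cast_inj]
  split_ifs at h with h1 h2
  · simp at h; rw [h, min_eq_left h1.le]
  · simp at h; rw [h, min_eq_right h2.le]
  · have := le_antisymm (not_lt.1 h1) (not_lt.1 h2)
    have h := (PMF.mem_support_uniformOfFinset_iff _ _).1 h
    rw [Finset.mem_insert, Finset.mem_singleton] at h
    rcases h with rfl | rfl <;> simp [this]

/-- Since `min a b = (a + b - |a - b|) / 2`, averaging over pairs gives the mean queue minus a
multiple of the total pairwise spread, which dominates `‖q_⊥‖`. -/
theorem integral_routeLaw_le (hM : 2 ≤ M) (Y : State M) :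
    ∫ m, realQueue Y m ∂(routeLaw hM Y).toMeasure ≤
      totalQueue Y / M - ‖perp (queueVec Y)‖ / (2 * M) := by
  have h1 : ∫ m, realQueue Y m ∂(routeLaw hM Y).toMeasure ≤
      ∫ p : Fin M × Fin M, min (realQueue Y p.1) (realQueue Y p.2) ∂(samplePair hM).toMeasure :=
    integral_bind_le .of_finite .of_finite fun p _ h =>
      integral_le_of_le h fun m hm => (realQueue_of_mem_support_shorterQueue hm).le
  have hM0 : (2 : ℝ) ≤ M := by exact_mod_cast hM
  have h2 : ∫ p : Fin M × Fin M, min (realQueue Y p.1) (realQueue Y p.2)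
      ∂(samplePair hM).toMeasure = ((serverPairs M).card : ℝ)⁻¹ *
        ∑ p ∈ serverPairs M, min (realQueue Y p.1) (realQueue Y p.2) := by
    rw [PMF.integral_eq_sum, Finset.mul_sum, ← Finset.sum_subset (Finset.subset_univ
      (serverPairs M))]
    · refine Finset.sum_congr rfl fun p hp => ?_
      simp [samplePair, hp]
    · intro p _ hp
      simp [samplePair, hp]
  have h3 := norm_perp_le_sum_abs (by omega) (queueVec Y)
  simp only [queueVec_apply] at h3
  rw [h2, sum_pairs_min, card_serverPairs] at h1
  refine h1.trans ?_
  rw [← totalQueue_eq]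
  set W := ∑ i, ∑ j, |realQueue Y i - realQueue Y j|
  set T := totalQueue Y
  set z := ‖perp (queueVec Y)‖
  have hz : 0 ≤ z := norm_nonneg _
  have hM1 : (0 : ℝ) < M - 1 := by linarith
  have h4 : ((M : ℝ) * (M - 1) / 2)⁻¹ * (((M - 1) * T - W / 2) / 2) =
      T / M - W / (2 * M * (M - 1)) := by
    field_simp
  rw [h4]
  refine sub_le_sub_left ?_ _
  rw [div_le_div_iff₀ (by positivity) (by positivity)]
  have h5 : z * (M - 1) ≤ W := by linarith
  have h6 := mul_le_mul_of_nonneg_right h5 (by positivity : (0 : ℝ) ≤ 2 * M)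
  linarith

end Routing

/-! ### From exponential to polynomial moments -/

section Moments

variable {α : Type*} [MeasurableSpace α] [DiscreteMeasurableSpace α]

/-- The Lyapunov function is infinite off `good`, so a finite expectation also confines the support.
-/
theorem exp_moment_of_tsum_le [Countable α] {p : PMF α} {good : Set α} {Z : α → ℝ} {θ C : ℝ}
    (hC : 0 ≤ C) (h : ∑' x, p x * expLyapunov good Z θ x ≤ ENNReal.ofReal C) :
    (∀ x ∈ p.support, x ∈ good) ∧ Integrable (fun x => Real.exp (θ * Z x)) p.toMeasure ∧
      ∫ x, Real.exp (θ * Z x) ∂p.toMeasure ≤ C := by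
  have hgood : ∀ x ∈ p.support, x ∈ good := by
    intro x hx
    by_contra hn
    have h1 : p x * expLyapunov good Z θ x = ∞ := by
      rw [expLyapunov, if_neg hn, ENNReal.mul_top ((PMF.mem_support_iff _ _).1 hx)]
    have h2 := (ENNReal.le_tsum x).trans h
    rw [h1] at h2
    exact ENNReal.ofReal_ne_top (top_le_iff.1 h2)
  have hl : ∫⁻ x, ENNReal.ofReal (Real.exp (θ * Z x)) ∂p.toMeasure ≤ ENNReal.ofReal C := by
    rw [lintegral_toMeasure]
    refine le_trans (ENNReal.tsum_le_tsum fun x => ?_) h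
    gcongr
    rw [expLyapunov]
    split_ifs <;> simp
  have hint : Integrable (fun x => Real.exp (θ * Z x)) p.toMeasure := by
    refine ⟨(Measurable.of_discrete).aestronglyMeasurable, ?_⟩
    rw [hasFiniteIntegral_iff_ofReal (ae_of_all _ fun x => (Real.exp_pos _).le)]
    exact lt_of_le_of_lt hl ENNReal.ofReal_lt_top
  refine ⟨hgood, hint, ?_⟩
  rw [← ENNReal.ofReal_le_ofReal_iff hC, ofReal_integral_eq_lintegral_ofReal hint
    (ae_of_all _ fun x => (Real.exp_pos _).le)]
  exact hl

theorem integrable_pow_of_exp {p : PMF α} {Z : α → ℝ} {θ : ℝ} (hθ : 0 < θ) (hZ : ∀ x, 0 ≤ Z x)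
    (h : Integrable (fun x => Real.exp (θ * Z x)) p.toMeasure) (r : ℕ) :
    Integrable (fun x => Z x ^ r) p.toMeasure ∧
      ∫ x, Z x ^ r ∂p.toMeasure ≤
        r.factorial / θ ^ r * ∫ x, Real.exp (θ * Z x) ∂p.toMeasure := by
  have hle : ∀ x, Z x ^ r ≤ r.factorial / θ ^ r * Real.exp (θ * Z x) := by
    intro x
    have h1 := Real.pow_div_factorial_le_exp (θ * Z x) (by have := hZ x; positivity) r
    have h2 : Z x ^ r = r.factorial / θ ^ r * ((θ * Z x) ^ r / r.factorial) := by
      have := Nat.factorial_ne_zero r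
      rw [mul_pow]
      field_simp
    rw [h2]
    gcongr
  have hint : Integrable (fun x => Z x ^ r) p.toMeasure := by
    refine Integrable.mono' (h.const_mul (r.factorial / θ ^ r))
      (Measurable.of_discrete).aestronglyMeasurable (ae_of_all _ fun x => ?_)
    rw [Real.norm_of_nonneg (pow_nonneg (hZ x) r)]
    exact hle x
  refine ⟨hint, ?_⟩
  rw [← integral_const_mul]
  exact integral_mono hint (h.const_mul _) hle

end Moments

/-! ### Drift of the norm and of its perpendicular part -/

section Drift

variable {M : ℕ}

theorem QueueStep.sum_abs_sub_le {μ D a : ℝ} {q q' : Fin M → ℝ} {m : Fin M} (ha : 0 ≤ a)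
    (h : QueueStep μ D q q' m a) : ∑ j, |q' j - q j| ≤ a + M * μ := by
  obtain ⟨u, hu⟩ := h
  calc ∑ j, |q' j - q j| ≤ ∑ j, ((if j = m then a else 0) + μ) := by
        refine Finset.sum_le_sum fun j _ => ?_
        obtain ⟨h1, h2, h3, -, -⟩ := hu j
        rw [h1, abs_le]
        split_ifs <;> constructor <;> linarith
    _ = a + M * μ := by simp [Finset.sum_add_distrib]

/-- In the cross term the unused service meets only queues of length at most `μ * D`, costing a
constant per server; since `c ≥ 0`, the part `-c * u j` can be dropped. -/
theorem QueueStep.sum_sub_sq_le {μ D a c : ℝ} {q q' : Fin M → ℝ} {m : Fin M} (ha : 0 ≤ a)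
    (hμ : 0 ≤ μ) (hD : 0 ≤ D) (hc : 0 ≤ c) (h : QueueStep μ D q q' m a) :
    ∑ j, (q' j - c) ^ 2 ≤ ∑ j, (q j - c) ^ 2 +
      2 * (a * (q m - c) - μ * ∑ j, (q j - c) + M * (μ * (μ * D))) + (a + M * μ) ^ 2 := by
  have habs := h.sum_abs_sub_le ha
  obtain ⟨u, hu⟩ := h
  have hsq : ∑ j, (q' j - q j) ^ 2 ≤ (a + M * μ) ^ 2 := by
    calc ∑ j, (q' j - q j) ^ 2 ≤ (∑ j, |q' j - q j|) ^ 2 := by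
          simpa using Finset.sum_sq_le_sq_sum_of_nonneg (s := Finset.univ)
            (f := fun j => |q' j - q j|) fun j _ => abs_nonneg _
      _ ≤ _ := by gcongr
  have hinner : ∑ j, (q j - c) * (q' j - q j) ≤
      a * (q m - c) - μ * ∑ j, (q j - c) + M * (μ * (μ * D)) := by
    calc ∑ j, (q j - c) * (q' j - q j)
        ≤ ∑ j, ((if j = m then a * (q j - c) else 0) - μ * (q j - c) + μ * (μ * D)) := by
          refine Finset.sum_le_sum fun j _ => ?_
          obtain ⟨h1, h2, h3, h4, -⟩ := hu j
          have h5 : u j * (μ * D) ≤ μ * (μ * D) := by gcongr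
          have h6 : 0 ≤ u j * c := by positivity
          rw [h1]
          split_ifs <;> linarith
      _ = _ := by
          simp [Finset.sum_add_distrib, Finset.sum_sub_distrib, ← Finset.mul_sum]
  have hexp : ∑ j, (q' j - c) ^ 2 = ∑ j, (q j - c) ^ 2 +
      2 * ∑ j, (q j - c) * (q' j - q j) + ∑ j, (q' j - q j) ^ 2 := by
    rw [Finset.mul_sum, ← Finset.sum_add_distrib, ← Finset.sum_add_distrib]
    exact Finset.sum_congr rfl fun j _ => by ring
  linarith

/-- The constant part of the drift of the squared norm of the queue lengths. -/
def driftConst (M μ D Amax : ℕ) : ℝ := 2 * (M * (μ * (μ * D))) + (Amax + M * μ) ^ 2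

theorem driftConst_nonneg (M μ D Amax : ℕ) : 0 ≤ driftConst M μ D Amax := by
  unfold driftConst; positivity

variable {μ D Amax : ℕ} {hM : 2 ≤ M} {arr : PMF (List ℕ)}
  {rule : State M → PMF (Fin M → Finset ℕ)}

theorem norm_queueVec_sub_le (hrule : IsServiceRule μ rule) (harr : IsArrivalLaw D Amax arr)
    {Y : State M} (hY : Y ∈ goodState M D) {Y' : State M}
    (hY' : Y' ∈ (po2Step hM arr rule Y).support) :
    ‖queueVec Y' - queueVec Y‖ ≤ Amax + M * μ := by
  obtain ⟨-, A, hA, m, h⟩ := po2Step_support hrule harr hY hY'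
  have hA' : (A.sum : ℝ) ≤ Amax := by exact_mod_cast harr.bdd A hA
  refine (norm_le_sum_abs _).trans ((h.sum_abs_sub_le (Nat.cast_nonneg _)).trans ?_)
  gcongr

/-- A bound on the increment of `Z²` bounds that of `Z` because `2z(z' - z) ≤ z'² - z²`. It serves
both `‖q‖` (`c = 0`) and `‖q_⊥‖` (`c` the old mean, whence only an inequality after the step). -/
theorem integral_po2Step_le_of_sq (hrule : IsServiceRule μ rule)
    (harr : IsArrivalLaw D Amax arr) {Y : State M} (hY : Y ∈ goodState M D) {Z : State M → ℝ}
    (hZ : Integrable Z (po2Step hM arr rule Y).toMeasure) {c : ℝ} (hc : 0 ≤ c) (hpos : 0 < Z Y)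
    (hsq : Z Y ^ 2 = ∑ j, (realQueue Y j - c) ^ 2)
    (hsq' : ∀ Y', Z Y' ^ 2 ≤ ∑ j, (realQueue Y' j - c) ^ 2) :
    ∫ Y', Z Y' ∂(po2Step hM arr rule Y).toMeasure ≤ Z Y +
      (2 * (arrivalRate arr * (∫ m, realQueue Y m ∂(routeLaw hM Y).toMeasure - c) -
        μ * ∑ j, (realQueue Y j - c)) + driftConst M μ D Amax) / (2 * Z Y) := by
  set z := Z Y
  set s := ∑ j, (realQueue Y j - c)
  set K := driftConst M μ D Amax with hK
  refine (integral_po2Step_le hrule harr hY hZ (G := fun A m => z +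
    (2 * (workload A * (realQueue Y m - c) - μ * s) + K) / (2 * z)) ?_).trans_eq ?_
  · intro A hA m Y' _ h
    have ha : (A.sum : ℝ) ≤ Amax := by exact_mod_cast harr.bdd A hA
    have h1 := h.sum_sub_sq_le (Nat.cast_nonneg _) (Nat.cast_nonneg _) (Nat.cast_nonneg _) hc
    have h2 := (hsq' Y').trans h1
    rw [← hsq] at h2
    have h3 : ((A.sum : ℝ) + M * μ) ^ 2 ≤ (Amax + M * μ) ^ 2 := by gcongr
    have h4 : Z Y' ^ 2 - z ^ 2 ≤ 2 * (workload A * (realQueue Y m - c) - μ * s) + K := by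
      simp only [hK, driftConst, workload]
      linarith
    rw [← sub_le_iff_le_add', le_div_iff₀ (by positivity)]
    nlinarith [sq_nonneg (Z Y' - z)]
  · have hint : Integrable (realQueue Y) (routeLaw hM Y).toMeasure := .of_finite
    have hrw : ∀ A m, z + (2 * (workload A * (realQueue Y m - c) - μ * s) + K) / (2 * z) =
        (z + (K - 2 * μ * s) / (2 * z) - c * (workload A / z)) +
          (workload A / z) * realQueue Y m := fun A m => by field_simp; ring
    simp only [hrw]
    have h1 : ∀ A, ∫ m, ((z + (K - 2 * μ * s) / (2 * z) - c * (workload A / z)) +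
          (workload A / z) * realQueue Y m) ∂(routeLaw hM Y).toMeasure =
        z + (K - 2 * μ * s) / (2 * z) +
          workload A * ((∫ m, realQueue Y m ∂(routeLaw hM Y).toMeasure - c) / z) := fun A => by
      rw [integral_add (by fun_prop) (by fun_prop), integral_const_mul]
      simp
      ring
    simp only [h1]
    rw [integral_add (by fun_prop) (harr.integrable _), integral_mul_const]
    simp only [integral_const, probReal_univ, one_smul, arrivalRate]
    field_simp
    ring

theorem sum_realQueue_sub (Y : State M) (c : ℝ) :
    ∑ j, (realQueue Y j - c) = totalQueue Y - M * c := by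
  simp [totalQueue_eq]

theorem drift_bound {z δ κ K : ℝ} (hδ : 0 < δ) (hκ : κ = K / (2 * δ) + 1) (hK : 0 ≤ K)
    (hz : κ ≤ z) : 0 < z ∧ K / (2 * z) ≤ δ := by
  have h0 : 0 ≤ K / (2 * δ) := by positivity
  have hz0 : 0 < z := by linarith
  refine ⟨hz0, ?_⟩
  have h1 : K / (2 * δ) ≤ z := by linarith
  rw [div_le_iff₀ (by positivity)] at h1 ⊢
  linarith

theorem integrable_po2Step (hrule : IsServiceRule μ rule) (harr : IsArrivalLaw D Amax arr)
    {Y : State M} (hY : Y ∈ goodState M D) {Z : State M → ℝ}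
    (hZ : ∀ Y', |Z Y' - Z Y| ≤ ‖queueVec Y' - queueVec Y‖) :
    Integrable Z (po2Step hM arr rule Y).toMeasure := by
  refine integrable_of_bounded (C := |Z Y| + (Amax + M * μ)) fun Y' hY' => ?_
  have h1 := (hZ Y').trans (norm_queueVec_sub_le hrule harr hY hY')
  have h2 := abs_sub_abs_le_abs_sub (Z Y') (Z Y)
  linarith

/-- Routing is no worse than to an average queue, so spare capacity alone gives a drift `-2δ`; the
constant term takes back at most `δ` once the norm is large. -/
theorem norm_drift (hrule : IsServiceRule μ rule) (harr : IsArrivalLaw D Amax arr)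
    {δ : ℝ} (hδ : 0 < δ) (hrate0 : 0 ≤ arrivalRate arr)
    (hrate : 2 * δ * M ≤ M * μ - arrivalRate arr) {Y : State M} (hY : Y ∈ goodState M D)
    (hκ : driftConst M μ D Amax / (2 * δ) + 1 ≤ ‖queueVec Y‖) :
    ∫ Y', ‖queueVec Y'‖ ∂(po2Step hM arr rule Y).toMeasure ≤ ‖queueVec Y‖ - δ := by
  obtain ⟨hz, hKz⟩ := drift_bound hδ rfl (driftConst_nonneg M μ D Amax) hκ
  have hM0 : (0 : ℝ) < M := by positivity
  have h := integral_po2Step_le_of_sq (hM := hM) hrule harr hY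
    (integrable_po2Step hrule harr hY fun Y' => abs_norm_sub_norm_le _ _) le_rfl hz
    (by simp [norm_sq_eq_sum, queueVec_apply]) (fun Y' => by simp [norm_sq_eq_sum, queueVec_apply])
  rw [sum_realQueue_sub] at h
  refine h.trans ?_
  have hroute := integral_routeLaw_le hM Y
  have hperp : 0 ≤ ‖perp (queueVec Y)‖ / (2 * M) := by positivity
  have hT := norm_queueVec_le Y
  set z := ‖queueVec Y‖
  set T := totalQueue Y
  have h1 : arrivalRate arr * (∫ m, realQueue Y m ∂(routeLaw hM Y).toMeasure - 0) ≤
      arrivalRate arr * (T / M) := by gcongr; linarith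
  have h2 : arrivalRate arr * (T / M) - μ * (T - M * 0) ≤ - (2 * δ * z) := by
    have h3 : arrivalRate arr * (T / M) - μ * (T - M * 0) =
        - ((M * μ - arrivalRate arr) / M * T) := by field_simp; ring
    have h4 : 2 * δ ≤ (M * μ - arrivalRate arr) / M := by rwa [le_div_iff₀ hM0]
    have h5 : 2 * δ * z ≤ (M * μ - arrivalRate arr) / M * T :=
      mul_le_mul h4 hT hz.le (le_trans (by positivity) h4)
    linarith
  rw [add_div]
  have h6 : 2 * (arrivalRate arr * (∫ m, realQueue Y m ∂(routeLaw hM Y).toMeasure - 0) -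
      μ * (T - M * 0)) / (2 * z) ≤ - (2 * δ) := by
    rw [div_le_iff₀ (by positivity)]
    linarith
  linarith

/-- Deviations from the mean sum to zero, so the service term vanishes and the drift comes from the
routing gain. Hence only a lower bound on the arrival rate is needed, not spare capacity. -/
theorem perp_drift (hrule : IsServiceRule μ rule) (harr : IsArrivalLaw D Amax arr)
    {δ : ℝ} (hδ : 0 < δ) (hrate : 4 * δ * M ≤ arrivalRate arr)
    {Y : State M} (hY : Y ∈ goodState M D)
    (hκ : driftConst M μ D Amax / (2 * δ) + 1 ≤ ‖perp (queueVec Y)‖) :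
    ∫ Y', ‖perp (queueVec Y')‖ ∂(po2Step hM arr rule Y).toMeasure ≤
      ‖perp (queueVec Y)‖ - δ := by
  obtain ⟨hz, hKz⟩ := drift_bound hδ rfl (driftConst_nonneg M μ D Amax) hκ
  have hM1 : 0 < M := by omega
  have hM0 : (0 : ℝ) < M := by positivity
  have hT := totalQueue_nonneg Y
  have h := integral_po2Step_le_of_sq (hM := hM) hrule harr hY
    (Z := fun Y => ‖perp (queueVec Y)‖) (c := totalQueue Y / M)
    (integrable_po2Step hrule harr hY fun Y' => abs_norm_perp_sub_le hM1 _ _)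
    (by positivity) hz (norm_perp_sq _)
    (fun Y' => (norm_perp_sq _).trans_le (sum_sub_mean_sq_le hM1 _ _))
  rw [sum_realQueue_sub] at h
  refine h.trans ?_
  have hroute := integral_routeLaw_le hM Y
  set z := ‖perp (queueVec Y)‖
  set T := totalQueue Y
  have h0 : 0 ≤ arrivalRate arr := le_trans (by positivity) hrate
  have h1 : arrivalRate arr * (∫ m, realQueue Y m ∂(routeLaw hM Y).toMeasure - T / M) ≤
      - (2 * δ * z) := by
    have h2 : arrivalRate arr * (∫ m, realQueue Y m ∂(routeLaw hM Y).toMeasure - T / M) ≤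
        arrivalRate arr * (- (z / (2 * M))) := by gcongr; linarith
    have h3 : (4 * δ * M) * (z / (2 * M)) ≤ arrivalRate arr * (z / (2 * M)) := by gcongr
    have h4 : (4 * δ * M) * (z / (2 * M)) = 2 * δ * z := by field_simp; ring
    linarith
  have h5 : (μ : ℝ) * (T - M * (T / M)) = 0 := by field_simp; ring
  rw [h5, sub_zero, add_div]
  have h6 : 2 * (arrivalRate arr * (∫ m, realQueue Y m ∂(routeLaw hM Y).toMeasure - T / M)) /
      (2 * z) ≤ - (2 * δ) := by
    rw [div_le_iff₀ (by positivity)]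
    linarith
  linarith

end Drift

/-! ### Existence of the steady state and state-space collapse -/

section SteadyState

variable {M : ℕ}

theorem finite_expLyapunov_le (D : ℕ) {θ : ℝ} (hθ : 0 < θ) (k : ℕ) :
    {Y : State M | expLyapunov (goodState M D) (fun Y => ‖queueVec Y‖) θ Y ≤ k}.Finite := by
  refine (Set.Finite.pi' fun _ : Fin M => finite_lists_sum_le ⌊(k : ℝ) / θ⌋₊).subset ?_
  intro Y hY j
  have hY : expLyapunov (goodState M D) (fun Y => ‖queueVec Y‖) θ Y ≤ k := hY
  by_cases hg : Y ∈ goodState M D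
  swap
  · rw [expLyapunov, if_neg hg] at hY
    exact absurd hY (by simp)
  refine ⟨fun d hd => (hg j d hd).1, Nat.le_floor ?_⟩
  rw [expLyapunov, if_pos hg, ENNReal.ofReal_le_natCast] at hY
  rw [le_div_iff₀ hθ]
  have h1 := Real.add_one_le_exp (θ * ‖queueVec Y‖)
  have h2 : realQueue Y j ≤ ‖queueVec Y‖ := realQueue_le_norm Y j
  have h3 : θ * realQueue Y j ≤ θ * ‖queueVec Y‖ := by gcongr
  change realQueue Y j * θ ≤ k
  linarith

theorem empty_mem_goodState (M D : ℕ) : (fun _ => [] : State M) ∈ goodState M D := by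
  simp [goodState]

theorem queueVec_empty (M : ℕ) : queueVec (fun _ => [] : State M) = 0 := by
  ext j; simp [queueVec, queueLength]

/-- Under power-of-two-choices routing the chain has a steady state, in which the queue lengths
have an exponential moment, and the part perpendicular to `c₁` has an exponential moment that is
bounded uniformly in the arrival rate. -/
theorem exists_po2_steadyState (M μ D Amax : ℕ) (hM : 2 ≤ M) (hμ : 0 < μ) :
    ∃ θ : ℝ, 0 < θ ∧ ∃ C : ℝ, 0 < C ∧
      ∀ (rule : State M → PMF (Fin M → Finset ℕ)) (arr : PMF (List ℕ)),
        IsServiceRule μ rule → IsArrivalLaw D Amax arr → 0 ≤ arrivalRate arr →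
        arrivalRate arr < M * μ →
        ∃ π : PMF (State M), IsSteadyState (po2Step hM arr rule) π ∧
          (∀ Y ∈ π.support, Y ∈ goodState M D) ∧
          (∃ θ' : ℝ, 0 < θ' ∧
            Integrable (fun Y => Real.exp (θ' * ‖queueVec Y‖)) π.toMeasure) ∧
          Integrable (fun Y => Real.exp (θ * ‖perp (queueVec Y)‖)) π.toMeasure ∧
          ∫ Y, Real.exp (θ * ‖perp (queueVec Y)‖) ∂π.toMeasure ≤ C := by
  have hM1 : 0 < M := by omega
  have hM0 : (0 : ℝ) < M := by positivity
  have hμ0 : (0 : ℝ) < μ := by positivity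
  have hB : (0 : ℝ) < Amax + M * μ := by positivity
  obtain ⟨θ, hθ, C, hC, hmain⟩ := exists_exp_moment_bound (State M) hB
    -- With `δ = μ / 8` the collapse drift applies for rates at least `Mμ / 2`, and the norm drift
    -- for rates at most `Mμ / 2`. Both then share the same `θ` and `C`.
    (δ := μ / 8) (κ := driftConst M μ D Amax / (2 * (μ / 8)) + 1) (by positivity)
  refine ⟨θ, hθ, C, hC, fun rule arr hrule harr h0 h1 => ?_⟩
  have hgood : ∀ Z : State M → ℝ, (∀ Y Y', |Z Y' - Z Y| ≤ ‖queueVec Y' - queueVec Y‖) →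
      ∀ Y ∈ goodState M D, ∀ Y' ∈ (po2Step hM arr rule Y).support,
        Y' ∈ goodState M D ∧ |Z Y' - Z Y| ≤ Amax + M * μ := fun Z hZ Y hY Y' hY' =>
    ⟨(po2Step_support hrule harr hY hY').1,
      (hZ Y Y').trans (norm_queueVec_sub_le hrule harr hY hY')⟩
  have hnorm := hgood (fun Y => ‖queueVec Y‖) fun Y Y' => abs_norm_sub_norm_le _ _
  have hperp := hgood (fun Y => ‖perp (queueVec Y)‖) fun Y Y' => abs_norm_perp_sub_le hM1 _ _
  set x₀ : State M := fun _ => []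
  have hx₀ : x₀ ∈ goodState M D := empty_mem_goodState M D
  have hZ₀ : ‖queueVec x₀‖ = 0 := by rw [queueVec_empty]; simp
  have hZ₀' : ‖perp (queueVec x₀)‖ = 0 := by rw [queueVec_empty]; simp [perp]
  set ε := M * μ - arrivalRate arr
  have hε : 0 < ε := by simp only [ε]; linarith
  obtain ⟨θ', hθ', C', hC', hmain'⟩ := exists_exp_moment_bound (State M) hB
    (δ := ε / (2 * M)) (κ := driftConst M μ D Amax / (2 * (ε / (2 * M))) + 1) (by positivity)
  have hV := hmain' (po2Step hM arr rule) (goodState M D) (fun Y => ‖queueVec Y‖) x₀ hx₀ hZ₀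
    hnorm fun Y hY hκ => norm_drift hrule harr (by positivity) h0
      (by simp only [ε]; field_simp; exact le_rfl) hY hκ
  have hcollapse : ∀ n, ∑' Y, chainLaw (po2Step hM arr rule) x₀ n Y *
      expLyapunov (goodState M D) (fun Y => ‖perp (queueVec Y)‖) θ Y ≤ ENNReal.ofReal C := by
    have hMμ : (0 : ℝ) < M * μ := by positivity
    rcases le_total ((M : ℝ) * μ / 2) (arrivalRate arr) with h | h
    · exact hmain _ _ _ _ hx₀ hZ₀' hperp fun Y hY hκ =>
        perp_drift hrule harr (by positivity) (by linarith) hY hκ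
    · intro n
      refine le_trans (ENNReal.tsum_le_tsum fun Y => ?_) (hmain _ _ _ _ hx₀ hZ₀ hnorm
        (fun Y hY hκ => norm_drift hrule harr (by positivity) h0 (by linarith) hY hκ) n)
      gcongr
      unfold expLyapunov
      split_ifs
      · gcongr
        exact norm_perp_le hM1 _
      · exact le_rfl
  obtain ⟨π, hπ, hbound⟩ := exists_steadyState (po2Step hM arr rule) x₀
    (expLyapunov (goodState M D) (fun Y => ‖queueVec Y‖) θ')
    (finite_expLyapunov_le D hθ') _ ENNReal.ofReal_ne_top hV
  obtain ⟨hs, hi, -⟩ := exp_moment_of_tsum_le hC'.le (hbound _ _ hV)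
  obtain ⟨-, hi', hle⟩ := exp_moment_of_tsum_le hC.le (hbound _ _ hcollapse)
  exact ⟨π, hπ, hs, ⟨θ', hθ', hi⟩, hi', hle⟩

end SteadyState

/-! ### The upper bound from a quadratic test function -/

section UpperBound

variable {M μ D Amax : ℕ} {hM : 2 ≤ M} {arr : PMF (List ℕ)}
  {rule : State M → PMF (Fin M → Finset ℕ)}

/-- Write `T' = T - Mμ + a + U` with `U` the total unused service. For each server `T' * u j` splits
into `M * (u j * q' j)`, small because service is wasted only at short queues, and a perpendicular
part, handled by AM-GM with weight `t`. The resulting multiple of `U` is absorbed by the linear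
terms on the two sides. -/
theorem QueueStep.sq_sum_le {M : ℕ} (hM : 0 < M) {μ D a t : ℝ} {q q' : Fin M → ℝ} {m : Fin M}
    (ht : 0 < t) (h : QueueStep μ D q q' m a) :
    (∑ j, q' j) ^ 2 - (2 * M * μ * D + M * t * μ) * ∑ j, q' j -
        M / t * ∑ j, (q' j - (∑ i, q' i) / M) ^ 2 ≤
      ((∑ j, q j) - M * μ + a) ^ 2 -
        (2 * M * μ * D + M * t * μ) * ((∑ j, q j) - M * μ + a) := by
  obtain ⟨u, hu⟩ := h
  have hM0 : (0 : ℝ) < M := by positivity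
  set T := ∑ j, q j
  set T' := ∑ j, q' j with hT'
  set U := ∑ j, u j with hU
  have hbal : T' = T - M * μ + a + U := by
    have : T' = ∑ j, (q j + (if j = m then a else 0) - μ + u j) :=
      Finset.sum_congr rfl fun j _ => (hu j).1
    rw [this]
    simp [Finset.sum_add_distrib, Finset.sum_sub_distrib]
    ring
  have hcross : 2 * (T' * U) ≤ 2 * M * μ * D * U + M * t * μ * U +
      M / t * ∑ j, (q' j - T' / M) ^ 2 := by
    have h1 : ∀ j, 2 * (T' * u j) ≤ 2 * M * μ * D * u j + M * t * μ * u j +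
        M / t * (q' j - T' / M) ^ 2 := by
      intro j
      obtain ⟨-, h2, h3, -, h4⟩ := hu j
      set p := q' j - T' / M with hp
      have h5 : T' * u j = M * (u j * q' j) - M * (u j * p) := by
        rw [hp]; field_simp; ring
      have h6 : - (2 * (u j * p)) ≤ t * u j ^ 2 + p ^ 2 / t := by
        have h7 : 0 ≤ (t * u j + p) ^ 2 / t := by positivity
        have h8 : (t * u j + p) ^ 2 / t = t * u j ^ 2 + 2 * (u j * p) + p ^ 2 / t := by
          field_simp
          ring
        linarith
      have h9 : t * u j ^ 2 ≤ t * (μ * u j) := by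
        rw [sq]; gcongr
      have h10 : (M : ℝ) * (u j * q' j) ≤ M * (u j * (μ * D)) := by gcongr
      have h11 : (M : ℝ) * (- (2 * (u j * p))) ≤ M * (t * (μ * u j) + p ^ 2 / t) := by
        gcongr; linarith
      have h12 : (M : ℝ) * (p ^ 2 / t) = M / t * p ^ 2 := by ring
      rw [h5]
      linarith
    have h2 := Finset.sum_le_sum fun j (_ : j ∈ Finset.univ) => h1 j
    simpa only [← Finset.mul_sum, Finset.sum_add_distrib] using h2
  have hx : T - M * μ + a = T' - U := by linarith
  rw [hx]
  nlinarith [sq_nonneg U]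

theorem arrivalVar_eq (harr : IsArrivalLaw D Amax arr) :
    ∫ A, workload A ^ 2 ∂arr.toMeasure = arrivalVar arr + arrivalRate arr ^ 2 := by
  have h : MemLp workload 2 arr.toMeasure :=
    (memLp_two_iff_integrable_sq (Measurable.of_discrete).aestronglyMeasurable).2
      (harr.integrable _)
  rw [arrivalVar, variance_eq_sub h, arrivalRate]
  simp

theorem integral_quadratic (harr : IsArrivalLaw D Amax arr) (x c : ℝ) :
    ∫ A, ((x + workload A) ^ 2 - c * (x + workload A)) ∂arr.toMeasure =
      (x + arrivalRate arr) ^ 2 + arrivalVar arr - c * (x + arrivalRate arr) := by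
  have h : ∀ A, (x + workload A) ^ 2 - c * (x + workload A) =
      (x ^ 2 - c * x) + (2 * x - c) * workload A + workload A ^ 2 := fun A => by ring
  simp only [h]
  rw [integral_add (harr.integrable _) (harr.integrable _),
    integral_add (harr.integrable _) (harr.integrable _), integral_const_mul,
    arrivalVar_eq harr]
  simp only [integral_const, probReal_univ, one_smul, arrivalRate]
  ring

/-- The upper bound on the mean total queue length in terms of a bound on the second moment of
the part perpendicular to `c₁`. -/
theorem integral_totalQueue_le (hμ : 0 < μ) (hrule : IsServiceRule μ rule)
    (harr : IsArrivalLaw D Amax arr) {ε : ℝ} (hε : 0 < ε) (hrate : arrivalRate arr = M * μ - ε)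
    {π : PMF (State M)} (hπ : IsSteadyState (po2Step hM arr rule) π)
    (hgood : ∀ Y ∈ π.support, Y ∈ goodState M D)
    (h1 : Integrable totalQueue π.toMeasure)
    (h2 : Integrable (fun Y => totalQueue Y ^ 2) π.toMeasure)
    (h3 : Integrable (fun Y => ‖perp (queueVec Y)‖ ^ 2) π.toMeasure) {N : ℝ} (hN : 0 < N)
    (hle : ∫ Y, ‖perp (queueVec Y)‖ ^ 2 ∂π.toMeasure ≤ N) :
    ∫ Y, totalQueue Y ∂π.toMeasure ≤
      (arrivalVar arr + ε ^ 2) / (2 * ε) + M * Real.sqrt (N * μ / ε) + M * D * μ := by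
  have hM1 : 0 < M := by omega
  have hμ0 : (0 : ℝ) < μ := by positivity
  set R := Real.sqrt (N * μ / ε) with hR
  have hRpos : 0 < R := Real.sqrt_pos.2 (by positivity)
  have hRsq : R ^ 2 = N * μ / ε := Real.sq_sqrt (by positivity)
  -- This weight balances the two AM-GM errors: `M * t * μ * ε` and `M / t * N` both equal `M * R *
  -- ε`.
  set t := R / μ with ht
  have ht0 : 0 < t := by positivity
  set c : ℝ := 2 * M * μ * D + M * t * μ with hc
  set F : State M → ℝ := fun Y =>
    totalQueue Y ^ 2 - c * totalQueue Y - M / t * ‖perp (queueVec Y)‖ ^ 2 with hF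
  have hFint : Integrable F π.toMeasure := by fun_prop
  have hbind : (π.bind (po2Step hM arr rule)).toMeasure = π.toMeasure := congrArg _ hπ
  have hstat := integral_bind_le (p := π) (k := po2Step hM arr rule) (F := F)
    (G := fun Y => (totalQueue Y - ε) ^ 2 + arrivalVar arr - c * (totalQueue Y - ε))
    (by rw [hbind]; exact hFint)
    (by
      have : (fun Y : State M => (totalQueue Y - ε) ^ 2 + arrivalVar arr -
          c * (totalQueue Y - ε)) = fun Y => totalQueue Y ^ 2 - (2 * ε + c) * totalQueue Y +
            (ε ^ 2 + arrivalVar arr + c * ε) := by ext Y; ring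
      rw [this]
      fun_prop)
    fun Y hY hFY => by
      refine (integral_po2Step_le hrule harr (hgood Y hY) hFY (G := fun A _ =>
        (totalQueue Y - M * μ + workload A) ^ 2 - c * (totalQueue Y - M * μ + workload A))
        fun A _ m Y' _ h => ?_).trans_eq ?_
      · have := h.sq_sum_le hM1 ht0
        simp only [hF, norm_perp_sq]
        exact this
      · simp only [integral_const, probReal_univ, one_smul]
        rw [integral_quadratic harr, hrate]
        ring
  rw [hbind] at hstat
  have hL : ∫ Y, F Y ∂π.toMeasure = ∫ Y, totalQueue Y ^ 2 ∂π.toMeasure -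
      c * ∫ Y, totalQueue Y ∂π.toMeasure -
        M / t * ∫ Y, ‖perp (queueVec Y)‖ ^ 2 ∂π.toMeasure := by
    simp only [hF]
    rw [integral_sub (by fun_prop) (by fun_prop), integral_sub (by fun_prop) (by fun_prop),
      integral_const_mul, integral_const_mul]
  have hRt : ∫ Y, ((totalQueue Y - ε) ^ 2 + arrivalVar arr - c * (totalQueue Y - ε))
      ∂π.toMeasure = ∫ Y, totalQueue Y ^ 2 ∂π.toMeasure -
        (2 * ε + c) * ∫ Y, totalQueue Y ∂π.toMeasure +
          (ε ^ 2 + arrivalVar arr + c * ε) := by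
    have : (fun Y : State M => (totalQueue Y - ε) ^ 2 + arrivalVar arr -
        c * (totalQueue Y - ε)) = fun Y => totalQueue Y ^ 2 - (2 * ε + c) * totalQueue Y +
          (ε ^ 2 + arrivalVar arr + c * ε) := by ext Y; ring
    rw [this, integral_add (by fun_prop) (by fun_prop), integral_sub (by fun_prop) (by fun_prop),
      integral_const_mul]
    simp
  rw [hL, hRt] at hstat
  set E := ∫ Y, totalQueue Y ∂π.toMeasure
  have hP : M / t * ∫ Y, ‖perp (queueVec Y)‖ ^ 2 ∂π.toMeasure ≤ M / t * N := by gcongr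
  have hMN : M / t * N = M * R * ε := by
    have : N = R ^ 2 * ε / μ := by rw [hRsq]; field_simp
    rw [this, ht]
    field_simp
  have hcε : c * ε = 2 * (M * D * μ) * ε + M * R * ε := by
    rw [hc, ht]; field_simp
  have hfin : 2 * ε * E ≤ arrivalVar arr + ε ^ 2 + 2 * (M * R) * ε + 2 * (M * D * μ) * ε := by
    linarith
  have h4 : (arrivalVar arr + ε ^ 2) / (2 * ε) + M * R + M * D * μ =
      (arrivalVar arr + ε ^ 2 + 2 * (M * R) * ε + 2 * (M * D * μ) * ε) / (2 * ε) := by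
    field_simp
  rw [h4, le_div_iff₀ (by positivity)]
  linarith

end UpperBound

/-! ### The single-server queue -/

section SingleServer

variable {c D Amax : ℕ} {arr : PMF (List ℕ)}

theorem singleStep_reaches_zero (hc : 0 < c) (harr : [] ∈ arr.support) (φ : ℕ) :
    Relation.ReflTransGen (fun φ φ' => φ' ∈ (singleStep c arr φ).support) φ 0 := by
  induction φ using Nat.strong_induction_on with
  | _ φ ih =>
    rcases Nat.eq_zero_or_pos φ with rfl | h
    · exact .refl
    · refine .head ?_ (ih (φ - c) (by omega))
      exact (PMF.mem_support_map_iff _ _ _).2 ⟨[], harr, by simp⟩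

theorem integral_singleStep (c : ℕ) (arr : PMF (List ℕ)) (φ : ℕ) (f : ℕ → ℝ) :
    ∫ x, f x ∂(singleStep c arr φ).toMeasure = ∫ A, f (φ + A.sum - c) ∂arr.toMeasure := by
  rw [singleStep, ← PMF.toMeasure_map _ _ Measurable.of_discrete,
    integral_map (Measurable.of_discrete).aemeasurable
      (Measurable.of_discrete).aestronglyMeasurable]

theorem exists_single_steadyState (hc : 0 < c) (harr : IsArrivalLaw D Amax arr) {ε : ℝ}
    (hε : 0 < ε) (hrate : arrivalRate arr = c - ε) :
    ∃ ν : PMF ℕ, IsSteadyState (singleStep c arr) ν ∧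
      (∃ θ : ℝ, 0 < θ ∧ Integrable (fun φ : ℕ => Real.exp (θ * φ)) ν.toMeasure) ∧
      ∀ (f : ℕ → ℝ≥0∞) (B : ℝ≥0∞),
        (∀ n, ∑' φ, chainLaw (singleStep c arr) 0 n φ * f φ ≤ B) → ∑' φ, ν φ * f φ ≤ B := by
  -- From the level `κ = c` on the truncation never acts, so the drift is exactly `-ε`.
  obtain ⟨θ, hθ, C, hC, hmain⟩ := exists_exp_moment_bound ℕ (B := Amax + c) (κ := c)
    (by positivity) hε
  have hV := hmain (singleStep c arr) Set.univ (fun φ => φ) 0 (Set.mem_univ _) (by simp)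
    (fun φ _ φ' hφ' => by
      obtain ⟨A, hA, rfl⟩ := (PMF.mem_support_map_iff _ _ _).1 hφ'
      refine ⟨Set.mem_univ _, ?_⟩
      have hb := harr.bdd A hA
      rw [abs_le]
      have h1 : φ + A.sum - c ≤ φ + Amax := by omega
      have h2 : φ ≤ φ + A.sum - c + c := by omega
      have h1' : ((φ + A.sum - c : ℕ) : ℝ) ≤ φ + Amax := by exact_mod_cast h1
      have h2' : (φ : ℝ) ≤ ((φ + A.sum - c : ℕ) : ℝ) + c := by exact_mod_cast h2
      have h3 : (0 : ℝ) ≤ Amax := Nat.cast_nonneg _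
      have h4 : (0 : ℝ) ≤ c := Nat.cast_nonneg _
      constructor <;> linarith)
    (fun φ _ hφ => by
      rw [integral_singleStep]
      have hφ' : c ≤ φ := by exact_mod_cast hφ
      have : ∀ A : List ℕ, ((φ + A.sum - c : ℕ) : ℝ) = (φ - c) + workload A := fun A => by
        rw [Nat.cast_sub (by omega), workload]; push_cast; ring
      simp only [this]
      rw [integral_add (harr.integrable _) (harr.integrable _)]
      simp only [integral_const, probReal_univ, one_smul]
      change (φ : ℝ) - c + arrivalRate arr ≤ _
      linarith)
  have hfin : ∀ k : ℕ, {φ : ℕ | expLyapunov Set.univ (fun φ : ℕ => (φ : ℝ)) θ φ ≤ k}.Finite := by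
    intro k
    refine (Set.finite_Iic ⌊(k : ℝ) / θ⌋₊).subset fun φ hφ => Nat.le_floor ?_
    have hφ : expLyapunov Set.univ (fun φ : ℕ => (φ : ℝ)) θ φ ≤ k := hφ
    rw [expLyapunov, if_pos (Set.mem_univ _), ENNReal.ofReal_le_natCast] at hφ
    rw [le_div_iff₀ hθ]
    linarith [Real.add_one_le_exp (θ * φ)]
  obtain ⟨ν, hν, hbound⟩ := exists_steadyState (singleStep c arr) 0 _ hfin _
    ENNReal.ofReal_ne_top hV
  exact ⟨ν, hν, ⟨θ, hθ, (exp_moment_of_tsum_le hC.le (hbound _ _ hV)).2.1⟩, hbound⟩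

theorem le_integral_single (harr : IsArrivalLaw D Amax arr) {ε : ℝ} (hε : 0 < ε)
    (hrate : arrivalRate arr = c - ε) {ν : PMF ℕ} (hν : IsSteadyState (singleStep c arr) ν)
    (h1 : Integrable (fun φ : ℕ => (φ : ℝ)) ν.toMeasure)
    (h2 : Integrable (fun φ : ℕ => (φ : ℝ) ^ 2) ν.toMeasure) :
    (arrivalVar arr + ε ^ 2) / (2 * ε) - c / 2 ≤ ∫ φ, (φ : ℝ) ∂ν.toMeasure := by
  -- With `x = φ + a - c` and `-c ≤ x ≤ 0` one has `x² + c * x ≤ 0`, so truncation at zero can only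
  -- increase the quadratic; this fixes the linear coefficient `c`. The minus sign turns the lower
  -- bound into the form of `integral_bind_le`.
  set F : ℕ → ℝ := fun φ => - ((φ : ℝ) ^ 2 + c * φ)
  have hFint : Integrable F ν.toMeasure := by
    simp only [F]; exact (h2.add (h1.const_mul _)).neg
  have hbind : (ν.bind (singleStep c arr)).toMeasure = ν.toMeasure := congrArg _ hν
  have heq : (fun φ : ℕ => - (((φ : ℝ) - ε) ^ 2 + arrivalVar arr - (-c) * (φ - ε))) =
      fun φ : ℕ => (2 * ε - c) * (φ : ℝ) - (φ : ℝ) ^ 2 + (c * ε - ε ^ 2 - arrivalVar arr) := by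
    ext φ; ring
  have hstat := integral_bind_le (p := ν) (k := singleStep c arr) (F := F)
    (G := fun φ => - (((φ : ℝ) - ε) ^ 2 + arrivalVar arr - (-c) * (φ - ε)))
    (by rw [hbind]; exact hFint) (by rw [heq]; fun_prop)
    fun φ _ _ => by
      rw [integral_singleStep]
      have hq := integral_quadratic harr (φ - c : ℝ) (-c)
      rw [hrate] at hq
      have hx : (φ : ℝ) - c + (c - ε) = φ - ε := by ring
      rw [hx] at hq
      rw [← hq, ← integral_neg]
      refine integral_mono (harr.integrable _) (harr.integrable _) fun A => ?_
      simp only [F, workload]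
      rw [neg_le_neg_iff]
      rcases le_total c (φ + A.sum) with h | h
      · rw [Nat.cast_sub h]
        push_cast
        exact le_of_eq (by ring)
      · rw [Nat.sub_eq_zero_of_le h]
        have h' : (φ : ℝ) + A.sum ≤ c := by exact_mod_cast h
        have h0 : (0 : ℝ) ≤ (φ : ℝ) + A.sum := by positivity
        simp only [Nat.cast_zero]
        nlinarith
  rw [hbind, heq, integral_add (by fun_prop) (by fun_prop),
    integral_sub (by fun_prop) (by fun_prop), integral_const_mul] at hstat
  simp only [F] at hstat
  rw [integral_neg, integral_add h2 (h1.const_mul _), integral_const_mul] at hstat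
  simp only [integral_const, probReal_univ, one_smul] at hstat
  rw [sub_le_iff_le_add, div_le_iff₀ (by positivity)]
  linarith

end SingleServer

/-! ### Stochastic domination of the single-server queue -/

section Comparison

variable {M μ D Amax : ℕ} {hM : 2 ≤ M} {arr : PMF (List ℕ)}
  {rule : State M → PMF (Fin M → Finset ℕ)}

theorem le_tsum_mul {α : Type*} {p : PMF α} {g : α → ℝ≥0∞} {C : ℝ≥0∞}
    (h : ∀ x ∈ p.support, C ≤ g x) : C ≤ ∑' x, p x * g x := by
  calc C = ∑' x, p x * C := by rw [ENNReal.tsum_mul_right, p.tsum_coe, one_mul]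
    _ ≤ _ := ENNReal.tsum_le_tsum fun x => by
      by_cases hx : x ∈ p.support
      · gcongr; exact h x hx
      · simp [(PMF.apply_eq_zero_iff _ _).2 hx]

theorem tsum_singleStep_mul (c : ℕ) (arr : PMF (List ℕ)) (φ : ℕ) (f : ℕ → ℝ≥0∞) :
    ∑' x, singleStep c arr φ x * f x = ∑' A, arr A * f (φ + A.sum - c) := by
  rw [singleStep, PMF.map, tsum_bind_mul]
  refine tsum_congr fun A => ?_
  rw [tsum_eq_single (φ + A.sum - c) fun y hy => by simp [hy]]
  simp

theorem sum_queueLength_le_of_step {Y Y' : State M} {m : Fin M} {A : List ℕ}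
    (h : QueueStep μ D (realQueue Y) (realQueue Y') m A.sum) :
    (∑ j, queueLength Y j) + A.sum - M * μ ≤ ∑ j, queueLength Y' j := by
  obtain ⟨u, hu⟩ := h
  rw [tsub_le_iff_right]
  have h1 : (∑ j, realQueue Y j) + A.sum - M * μ ≤ ∑ j, realQueue Y' j := by
    calc (∑ j, realQueue Y j) + A.sum - M * μ =
          ∑ j, (realQueue Y j + (if j = m then (A.sum : ℝ) else 0) - μ) := by
          simp [Finset.sum_add_distrib, Finset.sum_sub_distrib]
      _ ≤ _ := Finset.sum_le_sum fun j _ => by have := hu j; linarith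
  simp only [realQueue] at h1
  have h2 : (∑ j, (queueLength Y j : ℝ)) + A.sum ≤ ∑ j, (queueLength Y' j : ℝ) + M * μ := by
    linarith
  exact_mod_cast h2

/-- One step of the single-server queue is dominated by one step of the system. -/
theorem tsum_singleStep_le (hrule : IsServiceRule μ rule) (harr : IsArrivalLaw D Amax arr)
    {Y : State M} (hY : Y ∈ goodState M D) {f : ℕ → ℝ≥0∞} (hf : Monotone f) :
    ∑' x, singleStep (M * μ) arr (∑ j, queueLength Y j) x * f x ≤
      ∑' Y', po2Step hM arr rule Y Y' * f (∑ j, queueLength Y' j) := by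
  rw [tsum_singleStep_mul, po2Step_eq, tsum_bind_mul]
  refine ENNReal.tsum_le_tsum fun A => ?_
  by_cases hA : A ∈ arr.support
  · gcongr
    refine le_tsum_mul fun Y' hY' => hf ?_
    obtain ⟨m, -, hm⟩ := (PMF.mem_support_bind_iff _ _ _).1 hY'
    obtain ⟨S, hS, rfl⟩ := (PMF.mem_support_map_iff _ _ _).1 hm
    exact sum_queueLength_le_of_step
      (queueStep_serveAll hY m (harr.size A hA) (hrule _ S hS))
  · simp [(PMF.apply_eq_zero_iff _ _).2 hA]

/-- Domination is proved by duality instead of a coupling: a single-server step maps monotone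
functions to monotone functions, and stationarity of `π` absorbs the step of the full system. The
induction starts from `0`, which lies below every state. -/
theorem tsum_chainLaw_single_le (hrule : IsServiceRule μ rule) (harr : IsArrivalLaw D Amax arr)
    {π : PMF (State M)} (hπ : IsSteadyState (po2Step hM arr rule) π)
    (hgood : ∀ Y ∈ π.support, Y ∈ goodState M D) (n : ℕ) :
    ∀ f : ℕ → ℝ≥0∞, Monotone f →
      ∑' φ, chainLaw (singleStep (M * μ) arr) 0 n φ * f φ ≤
        ∑' Y, π Y * f (∑ j, queueLength Y j) := by
  induction n with
  | zero =>
    intro f hf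
    rw [tsum_eq_single 0 fun y hy => by simp [chainLaw, hy]]
    simp only [chainLaw, PMF.pure_apply_self, one_mul]
    exact le_tsum_mul fun Y _ => hf (Nat.zero_le _)
  | succ n ih =>
    intro f hf
    rw [chainLaw, tsum_bind_mul]
    refine (ih (fun φ => ∑' x, singleStep (M * μ) arr φ x * f x) fun φ ψ h => ?_).trans ?_
    · simp only [tsum_singleStep_mul]
      refine ENNReal.tsum_le_tsum fun A => ?_
      gcongr
      exact hf (by omega)
    · conv_rhs => rw [← hπ, tsum_bind_mul]
      refine ENNReal.tsum_le_tsum fun Y => ?_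
      by_cases hY : Y ∈ π.support
      · gcongr
        exact tsum_singleStep_le hrule harr (hgood Y hY) hf
      · simp [(PMF.apply_eq_zero_iff _ _).2 hY]

end Comparison

/-- After multiplication by `ε` the collapse term becomes `b * √(N * ε)`, which vanishes, so both
bounds squeeze to `v / 2`. -/
theorem tendsto_heavy_traffic {V f : ℝ → ℝ} {v a b d N c : ℝ} (hc : 0 < c)
    (hV : Tendsto V (𝓝[>] 0) (𝓝 v))
    (hlow : ∀ ε ∈ Set.Ioo 0 c, (V ε + ε ^ 2) / (2 * ε) - a ≤ f ε)
    (hup : ∀ ε ∈ Set.Ioo 0 c, f ε ≤ (V ε + ε ^ 2) / (2 * ε) + b * Real.sqrt (N / ε) + d) :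
    Tendsto (fun ε => ε * f ε) (𝓝[>] 0) (𝓝 (v / 2)) := by
  have hε : Tendsto (fun ε : ℝ => ε) (𝓝[>] 0) (𝓝 0) := tendsto_nhdsWithin_of_tendsto_nhds tendsto_id
  have hmem : Set.Ioo 0 c ∈ 𝓝[>] (0 : ℝ) := Ioo_mem_nhdsGT hc
  have hL : Tendsto (fun ε => (V ε + ε ^ 2) / 2 - a * ε) (𝓝[>] 0) (𝓝 (v / 2)) := by
    have := ((hV.add (hε.pow 2)).div_const 2).sub (hε.const_mul a)
    simpa using this
  have hU : Tendsto (fun ε => (V ε + ε ^ 2) / 2 + b * Real.sqrt (N * ε) + d * ε) (𝓝[>] 0)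
      (𝓝 (v / 2)) := by
    have hs : Tendsto (fun ε => Real.sqrt (N * ε)) (𝓝[>] 0) (𝓝 0) := by
      have := (Real.continuous_sqrt.tendsto (N * 0)).comp (hε.const_mul N)
      simpa [Function.comp_def] using this
    have := (((hV.add (hε.pow 2)).div_const 2).add (hs.const_mul b)).add (hε.const_mul d)
    simpa using this
  refine tendsto_of_tendsto_of_tendsto_of_le_of_le' hL hU ?_ ?_
  · filter_upwards [hmem] with ε h
    have h0 : 0 < ε := h.1
    calc (V ε + ε ^ 2) / 2 - a * ε = ε * ((V ε + ε ^ 2) / (2 * ε) - a) := by field_simp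
      _ ≤ ε * f ε := by gcongr; exact hlow ε h
  · filter_upwards [hmem] with ε h
    have h0 : 0 < ε := h.1
    have hsqrt : Real.sqrt (N * ε) = ε * Real.sqrt (N / ε) := by
      rw [← Real.sqrt_sq h0.le, ← Real.sqrt_mul (sq_nonneg ε), Real.sqrt_sq h0.le]
      congr 1
      field_simp
    calc ε * f ε ≤ ε * ((V ε + ε ^ 2) / (2 * ε) + b * Real.sqrt (N / ε) + d) := by
          gcongr; exact hup ε h
      _ = _ := by rw [hsqrt]; field_simp

end PowerOfTwo

/-! ### Assembly of the theorem -/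

open PowerOfTwo in
theorem mainTheorem4 (M μ Dmax Amax : ℕ) (hM : 2 ≤ M) (hμ : 0 < μ)
    (rule : State M → PMF (Fin M → Finset ℕ)) (hrule : IsServiceRule μ rule)
    (arr : ℝ → PMF (List ℕ)) (σ : ℝ)
    (hsize : ∀ ε ∈ Set.Ioo (0 : ℝ) (M * μ), ∀ A ∈ (arr ε).support, ∀ d ∈ A, 1 ≤ d ∧ d ≤ Dmax)
    (hbdd : ∀ ε ∈ Set.Ioo (0 : ℝ) (M * μ), ∀ A ∈ (arr ε).support, A.sum ≤ Amax)
    (hzero : ∀ ε ∈ Set.Ioo (0 : ℝ) (M * μ), 0 < (arr ε).toMeasure {A | A.sum = 0})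
    (hrate : ∀ ε ∈ Set.Ioo (0 : ℝ) (M * μ), arrivalRate (arr ε) = M * μ - ε)
    (hvar : Tendsto (fun ε => arrivalVar (arr ε)) (𝓝[>] 0) (𝓝 (σ ^ 2))) :
    -- existence and uniqueness of the steady states
    (∀ ε ∈ Set.Ioo (0 : ℝ) (M * μ), ∃! π : PMF (State M),
      IsSteadyState (po2Step hM (arr ε) rule) π) ∧
    (∀ ε ∈ Set.Ioo (0 : ℝ) (M * μ), ∃! ν : PMF ℕ,
      IsSteadyState (singleStep (M * μ) (arr ε)) ν) ∧
    ∀ (π : ℝ → PMF (State M)) (ν : ℝ → PMF ℕ),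
      (∀ ε ∈ Set.Ioo (0 : ℝ) (M * μ), IsSteadyState (po2Step hM (arr ε) rule) (π ε)) →
      (∀ ε ∈ Set.Ioo (0 : ℝ) (M * μ), IsSteadyState (singleStep (M * μ) (arr ε)) (ν ε)) →
      -- finite means
      (∀ ε ∈ Set.Ioo (0 : ℝ) (M * μ),
        Integrable totalQueue (π ε).toMeasure ∧
        Integrable (fun φ : ℕ => (φ : ℝ)) (ν ε).toMeasure) ∧
      -- state-space collapse, and the upper bound
      (∃ N : ℕ → ℝ,
        (∀ r : ℕ, 1 ≤ r → ∀ ε ∈ Set.Ioo (0 : ℝ) (M * μ),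
          Integrable (fun Y => ‖perp (queueVec Y)‖ ^ r) (π ε).toMeasure ∧
          ∫ Y, ‖perp (queueVec Y)‖ ^ r ∂(π ε).toMeasure ≤ N r) ∧
        (∀ ε ∈ Set.Ioo (0 : ℝ) (M * μ),
          ∫ Y, totalQueue Y ∂(π ε).toMeasure ≤
            (arrivalVar (arr ε) + ε ^ 2) / (2 * ε) + M * Real.sqrt (N 2 * μ / ε)
              + M * Dmax * μ)) ∧
      -- the lower bound by the single-server queue
      (∀ ε ∈ Set.Ioo (0 : ℝ) (M * μ),
        (arrivalVar (arr ε) + ε ^ 2) / (2 * ε) - M * μ / 2 ≤ ∫ φ, (φ : ℝ) ∂(ν ε).toMeasure ∧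
        ∫ φ, (φ : ℝ) ∂(ν ε).toMeasure ≤ ∫ Y, totalQueue Y ∂(π ε).toMeasure) ∧
      -- the heavy-traffic limits coincide
      Tendsto (fun ε => ε * ∫ Y, totalQueue Y ∂(π ε).toMeasure) (𝓝[>] 0) (𝓝 (σ ^ 2 / 2)) ∧
      Tendsto (fun ε => ε * ∫ φ, (φ : ℝ) ∂(ν ε).toMeasure) (𝓝[>] 0) (𝓝 (σ ^ 2 / 2)) := by
  have hMμ : (0 : ℝ) < M * μ := by positivity
  have hM1 : 0 < M := by omega
  have harr : ∀ ε ∈ Set.Ioo (0 : ℝ) (M * μ), IsArrivalLaw Dmax Amax (arr ε) := fun ε hε => by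
    refine ⟨hsize ε hε, hbdd ε hε, ?_⟩
    by_contra hn
    refine (hzero ε hε).ne' ((PMF.toMeasure_apply_eq_zero_iff _ MeasurableSet.of_discrete).2
      (Set.disjoint_left.2 fun A hA h0 => ?_))
    have h0 : A.sum = 0 := h0
    rcases A with _ | ⟨d, l⟩
    · exact hn hA
    · have := (hsize ε hε _ hA d (by simp)).1
      simp at h0
      omega
  obtain ⟨θ, hθ, C, hC, hpo2⟩ := exists_po2_steadyState M μ Dmax Amax hM hμ
  have hex := fun ε (hε : ε ∈ Set.Ioo (0 : ℝ) (M * μ)) => hpo2 rule (arr ε) hrule (harr ε hε)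
    (by rw [hrate ε hε]; linarith [hε.2]) (by rw [hrate ε hε]; linarith [hε.1])
  have hrate' : ∀ ε ∈ Set.Ioo (0 : ℝ) (M * μ), arrivalRate (arr ε) = (M * μ : ℕ) - ε :=
    fun ε hε => by rw [hrate ε hε]; push_cast; rfl
  have hex' := fun ε (hε : ε ∈ Set.Ioo (0 : ℝ) (M * μ)) =>
    exists_single_steadyState (c := M * μ) (by positivity) (harr ε hε) hε.1 (hrate' ε hε)
  have huniq : ∀ ε ∈ Set.Ioo (0 : ℝ) (M * μ), ∀ π₁ π₂ : PMF (State M),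
      IsSteadyState (po2Step hM (arr ε) rule) π₁ → IsSteadyState (po2Step hM (arr ε) rule) π₂ →
      π₁ = π₂ := fun ε hε _ _ h₁ h₂ =>
    h₁.unique (po2Step_reaches_empty hμ hrule (harr ε hε).nil_mem) h₂
  have huniq' : ∀ ε ∈ Set.Ioo (0 : ℝ) (M * μ), ∀ ν₁ ν₂ : PMF ℕ,
      IsSteadyState (singleStep (M * μ) (arr ε)) ν₁ →
      IsSteadyState (singleStep (M * μ) (arr ε)) ν₂ → ν₁ = ν₂ := fun ε hε _ _ h₁ h₂ =>
    h₁.unique (singleStep_reaches_zero (by positivity) (harr ε hε).nil_mem) h₂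
  refine ⟨fun ε hε => ?_, fun ε hε => ?_, fun π ν hπ hν => ?_⟩
  · obtain ⟨π, hπ, -⟩ := hex ε hε
    exact ⟨π, hπ, fun π' h => huniq ε hε _ _ h hπ⟩
  · obtain ⟨ν, hν, -⟩ := hex' ε hε
    exact ⟨ν, hν, fun ν' h => huniq' ε hε _ _ h hν⟩
  -- By uniqueness the given stationary laws inherit the support and the moments of the constructed
  -- ones.
  have hgood : ∀ ε ∈ Set.Ioo (0 : ℝ) (M * μ), ∀ Y ∈ (π ε).support, Y ∈ goodState M Dmax :=
    fun ε hε => by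
      obtain ⟨π', h, hg, -⟩ := hex ε hε
      rw [huniq ε hε _ _ (hπ ε hε) h]
      exact hg
  have hpow : ∀ ε ∈ Set.Ioo (0 : ℝ) (M * μ), ∀ r : ℕ,
      Integrable (fun Y => totalQueue Y ^ r) (π ε).toMeasure := fun ε hε r => by
    obtain ⟨π', h, -, ⟨θ', hθ', hi⟩, -⟩ := hex ε hε
    rw [huniq ε hε _ _ (hπ ε hε) h]
    have h1 := (integrable_pow_of_exp hθ' (fun Y => norm_nonneg (queueVec Y)) hi r).1
    refine (h1.const_mul ((M : ℝ) ^ r)).mono' (Measurable.of_discrete).aestronglyMeasurable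
      (ae_of_all _ fun Y => ?_)
    have h0 := totalQueue_nonneg Y
    rw [Real.norm_of_nonneg (by positivity), ← mul_pow]
    gcongr
    exact totalQueue_le Y
  have hperp : ∀ ε ∈ Set.Ioo (0 : ℝ) (M * μ), ∀ r : ℕ,
      Integrable (fun Y => ‖perp (queueVec Y)‖ ^ r) (π ε).toMeasure ∧
      ∫ Y, ‖perp (queueVec Y)‖ ^ r ∂(π ε).toMeasure ≤ r.factorial / θ ^ r * C := fun ε hε r => by
    obtain ⟨π', h, -, -, hi, hle⟩ := hex ε hε
    rw [huniq ε hε _ _ (hπ ε hε) h]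
    obtain ⟨h1, h2⟩ := integrable_pow_of_exp hθ (fun Y => norm_nonneg (perp (queueVec Y))) hi r
    exact ⟨h1, h2.trans (by gcongr)⟩
  have hpow' : ∀ ε ∈ Set.Ioo (0 : ℝ) (M * μ), ∀ r : ℕ,
      Integrable (fun φ : ℕ => (φ : ℝ) ^ r) (ν ε).toMeasure := fun ε hε r => by
    obtain ⟨ν', h, ⟨θ', hθ', hi⟩, -⟩ := hex' ε hε
    rw [huniq' ε hε _ _ (hν ε hε) h]
    exact (integrable_pow_of_exp hθ' (fun φ : ℕ => Nat.cast_nonneg φ) hi r).1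
  have hint : ∀ ε ∈ Set.Ioo (0 : ℝ) (M * μ), Integrable totalQueue (π ε).toMeasure :=
    fun ε hε => by simpa using hpow ε hε 1
  have hint' : ∀ ε ∈ Set.Ioo (0 : ℝ) (M * μ), Integrable (fun φ : ℕ => (φ : ℝ)) (ν ε).toMeasure :=
    fun ε hε => by simpa using hpow' ε hε 1
  have hupper : ∀ ε ∈ Set.Ioo (0 : ℝ) (M * μ), ∫ Y, totalQueue Y ∂(π ε).toMeasure ≤
      (arrivalVar (arr ε) + ε ^ 2) / (2 * ε) +
        M * Real.sqrt (((2 : ℕ).factorial / θ ^ 2 * C) * μ / ε) + M * Dmax * μ := fun ε hε =>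
    integral_totalQueue_le hμ hrule (harr ε hε) hε.1 (hrate ε hε) (hπ ε hε) (hgood ε hε)
      (hint ε hε) (hpow ε hε 2) (hperp ε hε 2).1 (by positivity) (hperp ε hε 2).2
  have hlower : ∀ ε ∈ Set.Ioo (0 : ℝ) (M * μ),
      (arrivalVar (arr ε) + ε ^ 2) / (2 * ε) - M * μ / 2 ≤ ∫ φ, (φ : ℝ) ∂(ν ε).toMeasure :=
    fun ε hε => by
      have := le_integral_single (harr ε hε) hε.1 (hrate' ε hε) (hν ε hε) (hint' ε hε)
        (hpow' ε hε 2)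
      simpa using this
  have hcompare : ∀ ε ∈ Set.Ioo (0 : ℝ) (M * μ),
      ∫ φ, (φ : ℝ) ∂(ν ε).toMeasure ≤ ∫ Y, totalQueue Y ∂(π ε).toMeasure := fun ε hε => by
    obtain ⟨ν', h, -, hbound⟩ := hex' ε hε
    have hνeq := huniq' ε hε _ _ (hν ε hε) h
    have h1 := hbound (fun φ => ENNReal.ofReal φ) _ fun n =>
      tsum_chainLaw_single_le hrule (harr ε hε) (hπ ε hε) (hgood ε hε) n _
        fun φ ψ h => ENNReal.ofReal_le_ofReal (Nat.cast_le.2 h)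
    rw [← hνeq, tsum_mul_ofReal (hint' ε hε) fun φ => Nat.cast_nonneg φ] at h1
    have h2 : ∀ Y : State M, ((∑ j, queueLength Y j : ℕ) : ℝ) = totalQueue Y := fun Y => by
      simp [totalQueue]
    simp only [h2] at h1
    rw [tsum_mul_ofReal (hint ε hε) totalQueue_nonneg] at h1
    exact (ENNReal.ofReal_le_ofReal_iff (integral_nonneg totalQueue_nonneg)).1 h1
  refine ⟨fun ε hε => ⟨hint ε hε, hint' ε hε⟩,
    ⟨fun r => r.factorial / θ ^ r * C, fun r _ ε hε => hperp ε hε r, hupper⟩,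
    fun ε hε => ⟨hlower ε hε, hcompare ε hε⟩, ?_, ?_⟩
  · exact tendsto_heavy_traffic hMμ hvar (fun ε hε => (hlower ε hε).trans (hcompare ε hε)) hupper
  · exact tendsto_heavy_traffic hMμ hvar hlower fun ε hε => (hcompare ε hε).trans (hupper ε hε)
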